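/- For $\alpha\in\mathbb C$ let $f_\alpha(z)=e^{\alpha}-\exp\bigl(\alpha z\,\mathrm{Log}(1+1/z)\bigr)$, $z\in\mathbb C\setminus[-1,0]$ ($\mathrm{Log}$ is the principal logarithm), extended continuously within the closed right half-plane by $f_\alpha(0)=e^\alpha-1$. For fixed $c>1$, $r>0$ let $C(r,c)$ be the positively oriented boundary of the rectangle with corners $-c\pm ir$, $\pm ir$, and put $$\varphi_\alpha(s)=\frac1{2\pi i}\int_{C(r,c)}f_\alpha(z)e^{sz}\,dz,\qquad s\in\mathbb C .$$ Then $(\alpha,s)\mapsto\varphi_\alpha(s)$ is an entire function on $\mathbb C^2$, and the following hold. (i) As $\alpha\to0$, $\alpha\ne 0$, uniformly for $s$ in compact subsets of $\mathbb C$, $$\frac{\varphi_\alpha(s)}{\alpha e^{\alpha}}\longrightarrow w(s):=\sum_{n=0}^\infty\frac{(-1)^n}{n+2}\frac{s^n}{n!}=\begin{cases}\dfrac{1-(1+s)e^{-s}}{s^2},&s\ne0,\\[1ex] \tfrac12,&s=0.\end{cases}$$ The function $w$ has no real zeros but infinitely many complex zeros. They are the solutions $s\neq 0$ of $e^s=1+s$,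 and they are exactly the numbers $\xi_k=-W(k,-1/e)-1$, $k\in\mathbb Z\setminus\{-1,0\}$, where $W(k,\cdot)$ is the $k$-th branch of the Lambert $W$ function (in the standard convention of Corless, Gonnet, Hare, Jeffrey and Knuth). Moreover $\xi_1=\overline{\xi_{-2}}\approx 2.08884-7.46148\,i$ and $\xi_2=\overline{\xi_{-3}}\approx 2.66406-13.87905\,i$, where the errors of the real and imaginary parts are less than $10^{-5}$. (ii) For every $n\in\mathbb N$, $\varphi_\alpha$ has at least $n$ (distinct) non-real zeros when $|\alpha|$ is sufficiently small. (iii) As $|\alpha|\to\infty$ ($\alpha\in\mathbb C$), uniformly for $s$ in compact subsets of $\mathbb C$, $$\frac{\varphi_\alpha(s/\alpha)}{\alpha e^{\alpha}}\longrightarrow\frac{J_1(\sqrt{2s})}{\sqrt{2s}},$$ where $J_1(z)=\frac z2\sum_{n\ge0}(-1)^n\frac{(z/2)^{2n}}{n!\,(n+1)!}$ is the Bessel function of order $1$ and the right-hand side is understood as $\tfrac12$ at $s=0$. (iv) The positive zeros of $J_1$ form an infinite sequence $0<j_1<j_2<\cdots$. For every $n\in\mathbb N$, there are zeros $s_1(\alpha),\dots,s_n(\alpha)$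 of $\varphi_\alpha$, all simple, with $0<|s_1(\alpha)|<\cdots<|s_n(\alpha)|$ for all $\alpha\in\mathbb C$ with $|\alpha|$ sufficiently large, such that $$\lim_{|\alpha|\to\infty}\alpha\,s_k(\alpha)=\frac{j_k^2}{2},\qquad k=1,\dots,n .$$ If in addition $\alpha>0$ (and $\alpha$ is sufficiently large), then $s_k(\alpha)>0$ for $k=1,\dots,n$. (v) For $\alpha>0$, the entire function $\varphi_\alpha$ is of order one and type one; that is, with $M(R)=\max_{|s|=R}|\varphi_\alpha(s)|$, $$\limsup_{R\to\infty}\frac{\log\log M(R)}{\log R}=1,\qquad \limsup_{R\to\infty}\frac{\log M(R)}{R}=1 .$$ -/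

import Mathlib

open Complex Filter Topology

noncomputable section

/-- `f_α(z) = e^α - (1 + 1/z)^{α z} = e^α - exp(α z Log(1 + 1/z))`. With the principal logarithm this
formula is holomorphic on `ℂ \ [-1, 0]`, as `1 + 1/z` is a real number `≤ 0` only for `z ∈ [-1, 0)`. At
`z = 0` its value is the limit `e^α - 1`. -/
def fAlpha (α z : ℂ) : ℂ :=
  Complex.exp α - Complex.exp (α * z * Complex.log (1 + 1 / z))

/-- The integral of `F` along the boundary of the rectangle with corners `-c ± i r` and `± i r`,
traversed counterclockwise. -/
def rectIntegral (c r : ℝ) (F : ℂ → ℂ) : ℂ :=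
  (∫ x in (-c)..0, F (x - r * I)) + I * (∫ y in (-r)..r, F (y * I))
    - (∫ x in (-c)..0, F (x + r * I)) - I * (∫ y in (-r)..r, F (-c + y * I))

/-- `φ_α(s) = (1 / 2πi) ∫_{C(r,c)} f_α(z) e^{s z} dz`. -/
def phi (c r : ℝ) (α s : ℂ) : ℂ :=
  1 / (2 * Real.pi * I) * rectIntegral c r (fun z => fAlpha α z * Complex.exp (s * z))

/-- The entire function `(1 - (1 + s) e^{-s}) / s²`, with value `1/2` at `s = 0`. -/
def limitW (s : ℂ) : ℂ :=
  if s = 0 then 1 / 2 else (1 - (1 + s) * Complex.exp (-s)) / s ^ 2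

/-- The range of the `k`-th branch of the Lambert `W` function, in the standard convention of
Corless, Gonnet, Hare, Jeffrey and Knuth. For `w` outside `(-∞, -1]` it is described by
`w + Log w = Log z + 2πik` with `z = w e^w`, that is, by `(2k-1)π < Im w + Arg w ≤ (2k+1)π`
(this includes `w = 0` for `k = 0`).
The points of `(-∞, -1)` belong to the branch `-1` only, and the branch point `w = -1` belongs to the
branches `0` and `-1`. -/
def lambertRange (k : ℤ) : Set ℂ :=
  {w | (w.im = 0 ∧ w.re ≤ -1 ∧ (k = -1 ∨ (k = 0 ∧ w.re = -1))) ∨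
    (¬ (w.im = 0 ∧ w.re ≤ -1) ∧
      (2 * k - 1) * Real.pi < w.im + w.arg ∧ w.im + w.arg ≤ (2 * k + 1) * Real.pi)}

/-- `W(k, z)`: the solution `w` of `w e^w = z` in the range of the `k`-th branch. -/
def lambertW (k : ℤ) (z : ℂ) : ℂ :=
  Function.invFunOn (fun w : ℂ => w * Complex.exp w) (lambertRange k) z

/-- `ξ_k = -W(k, -1/e) - 1`. -/
def xi (k : ℤ) : ℂ :=
  -lambertW k (-1 / Complex.exp 1) - 1

/-- The Bessel function `J_1`. -/
def besselJ1 (z : ℂ) : ℂ :=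
  z / 2 * ∑' n : ℕ, (-1) ^ n * (z / 2) ^ (2 * n) / ((n.factorial : ℂ) * ((n + 1).factorial : ℂ))

/-- The entire function `J_1(√(2s)) / √(2s)`, whose value at `s = 0` is `1/2`. As `J_1(z) / z` is even,
the choice of the square root (here the principal one) does not matter. -/
def besselLimit (s : ℂ) : ℂ :=
  if s = 0 then 1 / 2
  else besselJ1 (Complex.sqrt (2 * s)) / Complex.sqrt (2 * s)

/-- Maximum modulus `M(R) = max_{|z| = R} |f(z)|`. -/
def maxModulus (f : ℂ → ℂ) (R : ℝ) : ℝ :=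
  sSup ((fun z => ‖f z‖) '' Metric.sphere (0 : ℂ) R)

/-- The order `limsup_{R → ∞} log log M(R) / log R` of an entire function. -/
def entireOrder (f : ℂ → ℂ) : EReal :=
  limsup (fun R : ℝ => ((Real.log (Real.log (maxModulus f R)) / Real.log R : ℝ) : EReal)) atTop

/-- The type `limsup_{R → ∞} log M(R) / R^ρ` of an entire function of order `ρ`. -/
def entireType (ρ : ℝ) (f : ℂ → ℂ) : EReal :=
  limsup (fun R : ℝ => ((Real.log (maxModulus f R) / R ^ ρ : ℝ) : EReal)) atTop

end

/-! Everything rests on replacing the rectangle by circles. The kernel $f_\alpha$ is holomorphic off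
$[-1,0]$ and continuous up to $0$ from the right half-plane, so Cauchy's theorem moves the contour
to any circle $|z|=\rho>1$ (`rectIntegral_eq_circleIntegral`). There $\varphi_\alpha$ is a Borel
transform: a kernel $\sum a_nz^{-n-1}$ becomes $\sum a_ns^n/n!$ (`hasSum_borelIntegral`), and
uniform convergence of kernels on the circle gives uniform convergence of transforms on compact sets
(`tendstoUniformlyOn_borelIntegral`).

Limits: $f_\alpha/e^\alpha=1-\exp(\alpha(z\,\mathrm{Log}(1+1/z)-1))$. Divided by $\alpha$, this
tends to $1-z\,\mathrm{Log}(1+1/z)$ as $\alpha\to0$, and the transform of that kernel is $w$. For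
large $\alpha$ the circle $|z|=|\alpha|$ and $z=\alpha u$ make the exponent tend to $-1/(2u)$; the
transform of $1-e^{-1/(2u)}$ is the Bessel function in (iii). Zeros pass from the limits to
$\varphi_\alpha$ by Hurwitz-type statements (`eventually_exists_zero`,
`exists_tendsto_simple_zero`).

Zeros of $w$: with $v=-s-1$, $e^s=1+s$ becomes $ve^v=-1/e$, or in logarithmic form
$v+\mathrm{Log}\,v=-1+(2k+1)\pi i$. For $k\ge1$ this is a fixed point equation for a contraction of
$\{\mathrm{Im}\ge2\pi\}$, so it has exactly one solution; conjugation exchanges $k$ and $-1-k$; for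
$k=0,-1$ there is no non-real solution (`not_log_eq_of_im_ne_zero`). The contraction estimate also
certifies the decimals.

Bessel zeros: with $\beta$ the Bessel limit, $y=s\beta$ satisfies $y''=-y/(2s)$. A monotone
quadratic form in $(y,y')$ gives simplicity, and Sturm comparison gives arbitrarily large zeros.

Growth: circles with $\rho\downarrow1$ bound the type by one. Conversely, the Laplace transform of
$t\mapsto\varphi_a(-t)$ at $x>1$ is $-f_a(-x)$, which is unbounded as $x\downarrow1$; hence
$\varphi_a(-t)$ is not $O(e^{\tau t})$ for any $\tau<1$ (`not_phi_neg_le`). -/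

/-! ### The exponent $z\,\mathrm{Log}(1+1/z)$ off the cut and near $0$ -/

/-- The complement of the segment `[-1, 0]` in the complex plane. -/
def cutComplement : Set ℂ := {z | z.im ≠ 0 ∨ z.re < -1 ∨ 0 < z.re}

lemma mem_cutComplement_of_one_lt_norm {z : ℂ} (hz : 1 < ‖z‖) : z ∈ cutComplement := by
  by_contra h
  simp only [cutComplement, Set.mem_ofPred_eq, not_or, not_not, not_lt] at h
  obtain ⟨h1, h2, h3⟩ := h
  have : ‖z‖ ≤ |z.re| + |z.im| := Complex.norm_le_abs_re_add_abs_im z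
  rw [h1, abs_zero, abs_of_nonpos h3] at this
  linarith

lemma one_add_inv_mem_slitPlane {z : ℂ} (hz : z ∈ cutComplement) : 1 + 1 / z ∈ slitPlane := by
  rw [mem_slitPlane_iff]
  by_cases hi : z.im = 0
  · left
    have hre : z = (z.re : ℂ) := by
      apply Complex.ext <;> simp [hi]
    have hz' : z.re < -1 ∨ 0 < z.re := by
      rcases hz with h | h
      · exact absurd hi h
      · exact h
    rw [hre]
    have : (1 + 1 / (z.re : ℂ)).re = 1 + 1 / z.re := by
      rw [← Complex.ofReal_one, ← Complex.ofReal_div, ← Complex.ofReal_add, Complex.ofReal_re]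
    rw [this]
    rcases hz' with h | h
    · have : -1 < 1 / z.re := by
        rw [lt_div_iff_of_neg (by linarith)]; linarith
      linarith
    · positivity
  · right
    have hz0 : z ≠ 0 := by rintro rfl; simp at hi
    have hn : Complex.normSq z ≠ 0 := by simpa using hz0
    simp [Complex.inv_im, hi, hz0]

lemma differentiableAt_mul_log {z : ℂ} (hz : z ∈ cutComplement) :
    DifferentiableAt ℂ (fun z : ℂ => z * Complex.log (1 + 1 / z)) z := by
  have hz0 : z ≠ 0 := by
    rintro rfl; simp [cutComplement] at hz; linarith
  have h : DifferentiableAt ℂ (fun z : ℂ => 1 + 1 / z) z := by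
    fun_prop (disch := assumption)
  exact differentiableAt_id.mul (h.clog (one_add_inv_mem_slitPlane hz))

/-- Writing $\log x=2\log\sqrt x\le2(\sqrt x-1)$ tames the logarithmic singularity; in the right
half-plane $|1+1/z|\ge1$, so the real part of the logarithm needs no lower bound. The right-hand
side tends to $0$ with $z$, which gives continuity at $0$. -/
lemma norm_mul_log_le {z : ℂ} (hz : 0 ≤ z.re) :
    ‖z * Complex.log (1 + 1 / z)‖ ≤ 2 * √(‖z‖ ^ 2 + ‖z‖) + ‖z‖ * Real.pi := by
  rcases eq_or_ne z 0 with rfl | hz0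
  · simp
  have hzp : 0 < ‖z‖ := norm_pos_iff.2 hz0
  have h1 : 1 ≤ ‖1 + 1 / z‖ := by
    have h2 : 0 ≤ (1 / z).re := by
      simp only [one_div, Complex.inv_re]
      exact div_nonneg hz (Complex.normSq_nonneg _)
    calc (1 : ℝ) ≤ (1 + 1 / z).re := by simp only [Complex.add_re, Complex.one_re]; linarith
      _ ≤ ‖1 + 1 / z‖ := Complex.re_le_norm _
  have h3 : ‖1 + 1 / z‖ ≤ 1 + 1 / ‖z‖ := by
    simpa using norm_add_le (1 : ℂ) (1 / z)
  have h4 : ‖Complex.log (1 + 1 / z)‖ ≤ 2 * √(1 + 1 / ‖z‖) + Real.pi := by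
    refine (Complex.norm_le_abs_re_add_abs_im _).trans ?_
    rw [Complex.log_re, Complex.log_im, abs_of_nonneg (Real.log_nonneg h1)]
    refine add_le_add ?_ (Complex.abs_arg_le_pi _)
    have h5 : Real.log ‖1 + 1 / z‖ ≤ Real.log (1 + 1 / ‖z‖) := Real.log_le_log (by linarith) h3
    have h6 : Real.log √(1 + 1 / ‖z‖) ≤ √(1 + 1 / ‖z‖) - 1 :=
      Real.log_le_sub_one_of_pos (by positivity)
    rw [Real.log_sqrt (by positivity)] at h6
    linarith
  rw [norm_mul]
  calc ‖z‖ * ‖Complex.log (1 + 1 / z)‖ ≤ ‖z‖ * (2 * √(1 + 1 / ‖z‖) + Real.pi) := by gcongr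
    _ = 2 * (‖z‖ * √(1 + 1 / ‖z‖)) + ‖z‖ * Real.pi := by ring
    _ = 2 * √(‖z‖ ^ 2 + ‖z‖) + ‖z‖ * Real.pi := by
      congr 2
      rw [show ‖z‖ ^ 2 + ‖z‖ = ‖z‖ ^ 2 * (1 + 1 / ‖z‖) by field_simp,
        Real.sqrt_mul (by positivity), Real.sqrt_sq hzp.le]

lemma continuousOn_mul_log :
    ContinuousOn (fun z : ℂ => z * Complex.log (1 + 1 / z)) {z | 0 ≤ z.re} := by
  intro z hz
  rcases eq_or_ne z 0 with rfl | hz0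
  · have h0 : Tendsto (fun z : ℂ => 2 * √(‖z‖ ^ 2 + ‖z‖) + ‖z‖ * Real.pi)
        (𝓝[{z | 0 ≤ z.re}] 0) (𝓝 0) := by
      have : Continuous (fun z : ℂ => 2 * √(‖z‖ ^ 2 + ‖z‖) + ‖z‖ * Real.pi) := by fun_prop
      have h := this.tendsto 0
      simp only [norm_zero] at h
      norm_num at h
      exact h.mono_left nhdsWithin_le_nhds
    rw [ContinuousWithinAt, zero_mul]
    refine squeeze_zero_norm' ?_ h0
    filter_upwards [self_mem_nhdsWithin] with w hw using norm_mul_log_le hw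
  · refine (differentiableAt_mul_log ?_).continuousAt.continuousWithinAt
    rcases (show (0:ℝ) ≤ z.re from hz).lt_or_eq with h | h
    · exact Or.inr (Or.inr h)
    · left
      intro hi
      exact hz0 (Complex.ext h.symm hi)

/-! ### Deforming the rectangle to a circle -/

/-- Integral along the boundary of `[a, b] × [c, d]`, counterclockwise. -/
noncomputable def boxIntegral (F : ℂ → ℂ) (a b c d : ℝ) : ℂ :=
  (∫ x in a..b, F (x + c * I)) - (∫ x in a..b, F (x + d * I))
    + I * (∫ y in c..d, F (b + y * I)) - I * (∫ y in c..d, F (a + y * I))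

lemma boxIntegral_eq_zero {F : ℂ → ℂ} {a b c d : ℝ} (hab : a ≤ b) (hcd : c ≤ d)
    (hc : ∀ z : ℂ, z.re ∈ Set.Icc a b → z.im ∈ Set.Icc c d →
      ContinuousWithinAt F {z | z.re ∈ Set.Icc a b ∧ z.im ∈ Set.Icc c d} z)
    (hd : ∀ z : ℂ, z.re ∈ Set.Ioo a b → z.im ∈ Set.Ioo c d → DifferentiableAt ℂ F z) :
    boxIntegral F a b c d = 0 := by
  have h := Complex.integral_boundary_rect_eq_zero_of_continuousOn_of_differentiableOn F
    (⟨a, c⟩ : ℂ) (⟨b, d⟩ : ℂ) (by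
      simp only [Set.uIcc_of_le hab, Set.uIcc_of_le hcd]
      intro z hz
      rw [Complex.mem_reProdIm] at hz
      refine (hc z hz.1 hz.2).mono ?_
      intro w hw
      rwa [Complex.mem_reProdIm] at hw) (by
      simp only [min_eq_left hab, min_eq_left hcd, max_eq_right hab, max_eq_right hcd]
      intro z hz
      rw [Complex.mem_reProdIm] at hz
      exact (hd z hz.1 hz.2).differentiableWithinAt)
  simpa [boxIntegral, smul_eq_mul] using h

lemma boxIntegral_eq_zero_of_subset {F : ℂ → ℂ}
    (hF : ∀ z ∈ cutComplement, DifferentiableAt ℂ F z) {a b c d : ℝ}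
    (hab : a ≤ b) (hcd : c ≤ d)
    (h : ∀ z : ℂ, z.re ∈ Set.Icc a b → z.im ∈ Set.Icc c d → z ∈ cutComplement) :
    boxIntegral F a b c d = 0 :=
  boxIntegral_eq_zero hab hcd
    (fun z h1 h2 => (hF z (h z h1 h2)).continuousAt.continuousWithinAt)
    (fun z h1 h2 => hF z (h z (Set.Ioo_subset_Icc_self h1) (Set.Ioo_subset_Icc_self h2)))

lemma continuous_horizontal {F : ℂ → ℂ} (hF : ∀ z ∈ cutComplement, DifferentiableAt ℂ F z)
    {y : ℝ} (hy : y ≠ 0) : Continuous (fun x : ℝ => F (x + y * I)) := by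
  refine continuous_iff_continuousAt.2 fun x => ?_
  have h : ContinuousAt F (x + y * I) := (hF _ (Or.inl (by simpa using hy))).continuousAt
  exact ContinuousAt.comp (f := fun x : ℝ => (x + y * I : ℂ)) h (by fun_prop)

lemma continuous_vertical {F : ℂ → ℂ} (hF : ∀ z ∈ cutComplement, DifferentiableAt ℂ F z)
    {x : ℝ} (hx : x < -1) : Continuous (fun y : ℝ => F (x + y * I)) := by
  refine continuous_iff_continuousAt.2 fun y => ?_
  have h : ContinuousAt F (x + y * I) := (hF _ (Or.inr (Or.inl (by simpa using hx)))).continuousAt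
  exact ContinuousAt.comp (f := fun y : ℝ => (x + y * I : ℂ)) h (by fun_prop)

lemma continuous_vertical_zero {F : ℂ → ℂ} (hF0 : ContinuousOn F {z | 0 ≤ z.re}) :
    Continuous (fun y : ℝ => F ((0 : ℝ) + y * I)) := by
  refine hF0.comp_continuous (by fun_prop) fun y => ?_
  simp

/-- The large square is the small rectangle together with four boxes, above, below, left and right,
on each of which Cauchy's theorem applies; the common edges cancel. -/
lemma boxIntegral_eq_square {F : ℂ → ℂ} (hF : ∀ z ∈ cutComplement, DifferentiableAt ℂ F z)
    (hF0 : ContinuousOn F {z | 0 ≤ z.re}) {c r d : ℝ} (hc : 1 < c) (hr : 0 < r)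
    (hcd : c ≤ d) (hrd : r ≤ d) :
    boxIntegral F (-c) 0 (-r) r = boxIntegral F (-d) d (-d) d := by
  have hd : 0 < d := hr.trans_le hrd
  have hT : boxIntegral F (-c) 0 r d = 0 :=
    boxIntegral_eq_zero_of_subset hF (by linarith) hrd fun z _ h =>
      Or.inl (by have := h.1; intro h'; linarith)
  have hB : boxIntegral F (-c) 0 (-d) (-r) = 0 :=
    boxIntegral_eq_zero_of_subset hF (by linarith) (by linarith) fun z _ h =>
      Or.inl (by have := h.2; intro h'; linarith)
  have hL : boxIntegral F (-d) (-c) (-d) d = 0 :=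
    boxIntegral_eq_zero_of_subset hF (by linarith) (by linarith) fun z h _ =>
      Or.inr (Or.inl (by have := h.2; linarith))
  -- The point $0$ lies on the left edge of this box, where only continuity from the right
  -- half-plane is available.
  have hR : boxIntegral F 0 d (-d) d = 0 :=
    boxIntegral_eq_zero (by linarith) (by linarith)
      (fun z h1 _ => (hF0 z h1.1).mono fun w hw => hw.1.1)
      (fun z h1 _ => hF z (Or.inr (Or.inr h1.1)))
  have v0 := continuous_vertical_zero hF0
  have vc := continuous_vertical hF (x := -c) (by linarith)
  have hp := continuous_horizontal hF (y := d) hd.ne'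
  have hm := continuous_horizontal hF (y := -d) (by linarith)
  have e1 : ∀ (G : ℝ → ℂ), Continuous G → ∫ y in (-d)..d, G y =
      (∫ y in (-d)..(-r), G y) + (∫ y in (-r)..r, G y) + ∫ y in r..d, G y := by
    intro G hG
    rw [intervalIntegral.integral_add_adjacent_intervals (hG.intervalIntegrable _ _)
      (hG.intervalIntegrable _ _), intervalIntegral.integral_add_adjacent_intervals
      (hG.intervalIntegrable _ _) (hG.intervalIntegrable _ _)]
  have e2 : ∀ (G : ℝ → ℂ), Continuous G → ∫ y in (-d)..d, G y =
      (∫ y in (-d)..(-c), G y) + (∫ y in (-c)..0, G y) + ∫ y in 0..d, G y := by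
    intro G hG
    rw [intervalIntegral.integral_add_adjacent_intervals (hG.intervalIntegrable _ _)
      (hG.intervalIntegrable _ _), intervalIntegral.integral_add_adjacent_intervals
      (hG.intervalIntegrable _ _) (hG.intervalIntegrable _ _)]
  have a1 := e1 _ v0
  have a2 := e1 _ vc
  have a3 := e2 _ hp
  have a4 := e2 _ hm
  simp only [boxIntegral] at hT hB hL hR ⊢
  linear_combination (-1 : ℂ) * hT - hB - hL - hR + I * a2 - I * a1 + a3 - a4

/-- One side of a centred square can be replaced by the circular arc with the same end points. -/
lemma integral_side_eq_integral_arc {G : ℂ → ℂ} (hG : ∀ z : ℂ, 1 < ‖z‖ → DifferentiableAt ℂ G z)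
    {d : ℝ} (hd : 1 < d) :
    I * (∫ y in (-d)..d, G (d + y * I)) =
      ∫ θ in (-(Real.pi / 4))..(Real.pi / 4), deriv (circleMap 0 (√2 * d)) θ •
        G (circleMap 0 (√2 * d) θ) := by
  -- The disc with centre $M$ and radius $M-1$ misses the closed unit disc. For $\mathrm{Re}\,z\ge
  -- d$ and $|z|^2\le2d^2$, the choice $M(d-1)=d^2$ makes $|z-M|<M-1$, so chord and arc lie in one
  -- disc on which $G$ has a primitive.
  set M : ℝ := d ^ 2 / (d - 1) with hM
  have hd1 : 0 < d - 1 := by linarith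
  have hMd : M * (d - 1) = d ^ 2 := by rw [hM]; field_simp
  have hM1 : 1 < M := by
    rw [hM, lt_div_iff₀ hd1]; nlinarith
  have hball : ∀ z ∈ Metric.ball (M : ℂ) (M - 1), 1 < ‖z‖ := by
    intro z hz
    rw [mem_ball_iff_norm'] at hz
    have : ‖(M : ℂ)‖ ≤ ‖(M : ℂ) - z‖ + ‖z‖ := by
      simpa using norm_add_le ((M : ℂ) - z) z
    rw [Complex.norm_real, Real.norm_of_nonneg (by linarith)] at this
    linarith
  have hmem : ∀ z : ℂ, z.re ^ 2 + z.im ^ 2 ≤ 2 * d ^ 2 → d ≤ z.re →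
      z ∈ Metric.ball (M : ℂ) (M - 1) := by
    intro z h1 h2
    rw [mem_ball_iff_norm, ← sq_lt_sq₀ (norm_nonneg _) (by linarith), ← Complex.normSq_eq_norm_sq,
      Complex.normSq_apply]
    simp only [Complex.sub_re, Complex.sub_im, Complex.ofReal_re, Complex.ofReal_im]
    nlinarith [mul_le_mul_of_nonneg_left h2 (by linarith : (0:ℝ) ≤ M)]
  obtain ⟨P, hP⟩ := (show DifferentiableOn ℂ G (Metric.ball (M : ℂ) (M - 1)) from
    fun z hz => (hG z (hball z hz)).differentiableWithinAt).isExactOn_ball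
  have hs : √2 * √2 = 2 := Real.mul_self_sqrt (by norm_num)
  have hs0 : 0 < √2 := by positivity
  have hline : ∀ y ∈ Set.uIcc (-d) d, (d + y * I : ℂ) ∈ Metric.ball (M : ℂ) (M - 1) := by
    intro y hy
    rw [Set.uIcc_of_le (by linarith)] at hy
    apply hmem
    · simp; nlinarith [hy.1, hy.2]
    · simp
  have harc : ∀ θ ∈ Set.uIcc (-(Real.pi / 4)) (Real.pi / 4),
      circleMap 0 (√2 * d) θ ∈ Metric.ball (M : ℂ) (M - 1) := by
    intro θ hθ
    rw [Set.uIcc_of_le (by linarith [Real.pi_pos])] at hθ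
    have hre : (circleMap 0 (√2 * d) θ).re = √2 * d * Real.cos θ := by
      simp [circleMap, Complex.exp_ofReal_mul_I_re]
    have him : (circleMap 0 (√2 * d) θ).im = √2 * d * Real.sin θ := by
      simp [circleMap, Complex.exp_ofReal_mul_I_im]
    apply hmem
    · rw [hre, him]
      have := Real.sin_sq_add_cos_sq θ
      have h2 : (√2) ^ 2 = 2 := Real.sq_sqrt (by norm_num)
      rw [mul_pow, mul_pow, mul_pow, mul_pow, h2]
      nlinarith
    · rw [hre]
      have hcos : √2 / 2 ≤ Real.cos θ := by
        rw [← Real.cos_pi_div_four, ← Real.cos_abs θ]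
        exact Real.cos_le_cos_of_nonneg_of_le_pi (abs_nonneg _) (by linarith [Real.pi_pos])
          (abs_le.2 hθ)
      have : √2 * d * (√2 / 2) ≤ √2 * d * Real.cos θ := by gcongr
      nlinarith
  have hGc : ∀ z ∈ Metric.ball (M : ℂ) (M - 1), ContinuousAt G z :=
    fun z hz => (hG z (hball z hz)).continuousAt
  have h1 : ∫ y in (-d)..d, I * G (d + y * I) = P (d + d * I) - P (d + (-d : ℝ) * I) := by
    refine intervalIntegral.integral_eq_sub_of_hasDerivAt (f := fun y : ℝ => P (d + y * I)) ?_ ?_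
    · intro y hy
      have hin : HasDerivAt (fun y : ℝ => (d + y * I : ℂ)) I y := by
        simpa using ((Complex.ofRealCLM.hasDerivAt (x := y)).mul_const I).const_add (d : ℂ)
      have := (hP _ (hline y hy)).comp y hin
      rwa [mul_comm] at this
    · refine ContinuousOn.intervalIntegrable fun y hy => ?_
      refine (continuousAt_const.mul ?_).continuousWithinAt
      exact ContinuousAt.comp (f := fun y : ℝ => (d + y * I : ℂ)) (hGc _ (hline y hy)) (by fun_prop)
  have h2 : ∫ θ in (-(Real.pi / 4))..(Real.pi / 4), deriv (circleMap 0 (√2 * d)) θ •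
        G (circleMap 0 (√2 * d) θ) = P (circleMap 0 (√2 * d) (Real.pi / 4)) -
          P (circleMap 0 (√2 * d) (-(Real.pi / 4))) := by
    refine intervalIntegral.integral_eq_sub_of_hasDerivAt
      (f := fun θ : ℝ => P (circleMap 0 (√2 * d) θ)) ?_ ?_
    · intro θ hθ
      have := (hP _ (harc θ hθ)).comp θ (hasDerivAt_circleMap 0 (√2 * d) θ)
      rw [deriv_circleMap, smul_eq_mul, mul_comm (circleMap 0 (√2 * d) θ * I)]
      exact this
    · refine ContinuousOn.intervalIntegrable fun θ hθ => ?_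
      refine ContinuousAt.continuousWithinAt (ContinuousAt.fun_smul ?_ ?_)
      · exact (contDiff_circleMap 0 (√2 * d) (n := 1)).continuous_deriv_one.continuousAt
      · exact ContinuousAt.comp (f := circleMap 0 (√2 * d)) (hGc _ (harc θ hθ))
          (continuous_circleMap _ _).continuousAt
  have c1 : circleMap 0 (√2 * d) (Real.pi / 4) = d + d * I := by
    apply Complex.ext
    · simp only [circleMap, Complex.exp_ofReal_mul_I_re, zero_add, Complex.re_ofReal_mul,
        Real.cos_pi_div_four]
      simp; nlinarith
    · simp only [circleMap, Complex.exp_ofReal_mul_I_im, zero_add, Complex.im_ofReal_mul,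
        Real.sin_pi_div_four]
      simp; nlinarith
  have c2 : circleMap 0 (√2 * d) (-(Real.pi / 4)) = d + (-d : ℝ) * I := by
    apply Complex.ext
    · simp only [circleMap, Complex.exp_ofReal_mul_I_re, zero_add, Complex.re_ofReal_mul,
        Real.cos_neg, Real.cos_pi_div_four]
      simp; nlinarith
    · simp only [circleMap, Complex.exp_ofReal_mul_I_im, zero_add, Complex.im_ofReal_mul,
        Real.sin_neg, Real.sin_pi_div_four]
      simp; nlinarith
  rw [h2, c1, c2, ← h1, intervalIntegral.integral_const_mul]

/-- The four sides are the rotations by $1,i,-1,-i$ of the right-hand side; the corresponding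
quarter arcs fill one period starting at $-\pi/4$. -/
lemma boxIntegral_square_eq_circleIntegral {G : ℂ → ℂ}
    (hG : ∀ z : ℂ, 1 < ‖z‖ → DifferentiableAt ℂ G z) {d : ℝ} (hd : 1 < d) :
    boxIntegral G (-d) d (-d) d = ∮ z in C(0, √2 * d), G z := by
  set H : ℝ → ℂ := fun θ => deriv (circleMap 0 (√2 * d)) θ • G (circleMap 0 (√2 * d) θ) with hH
  have hρ : 1 < √2 * d := by
    have : (1:ℝ) < √2 := by rw [Real.lt_sqrt (by norm_num)]; norm_num
    nlinarith
  have hHc : Continuous H := by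
    refine continuous_iff_continuousAt.2 fun θ => ContinuousAt.fun_smul ?_ ?_
    · exact (contDiff_circleMap 0 (√2 * d) (n := 1)).continuous_deriv_one.continuousAt
    · refine ContinuousAt.comp (f := circleMap 0 (√2 * d)) ?_ (continuous_circleMap _ _).continuousAt
      refine (hG _ ?_).continuousAt
      rw [norm_circleMap_zero, abs_of_pos (by linarith)]; exact hρ
  have rot : ∀ ζ : ℂ, ‖ζ‖ = 1 → ∀ τ : ℝ, Complex.exp (τ * I) = ζ →
      ζ * (I * ∫ y in (-d)..d, G (ζ * (d + y * I))) =
        ∫ θ in (-(Real.pi / 4) + τ)..(Real.pi / 4 + τ), H θ := by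
    intro ζ hζ τ hτ
    have := integral_side_eq_integral_arc (G := fun z => G (ζ * z)) (fun z hz => by
      have h : DifferentiableAt ℂ G (ζ * z) := hG _ (by rw [norm_mul, hζ, one_mul]; exact hz)
      exact h.comp z (by fun_prop)) hd
    rw [this, ← intervalIntegral.integral_comp_add_right, ← intervalIntegral.integral_const_mul]
    congr 1 with θ
    have e : circleMap 0 (√2 * d) (θ + τ) = ζ * circleMap 0 (√2 * d) θ := by
      simp only [circleMap, zero_add, Complex.ofReal_add, add_mul, Complex.exp_add, hτ]; ring
    simp only [hH, deriv_circleMap, smul_eq_mul, e]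
    ring
  have r0 := rot 1 (by simp) 0 (by simp)
  have r1 := rot I (by simp) (Real.pi / 2) (by
    rw [Complex.ofReal_div]; exact_mod_cast Complex.exp_pi_div_two_mul_I)
  have r2 := rot (-1) (by simp) Real.pi Complex.exp_pi_mul_I
  have r3 := rot (-I) (by simp) (3 * Real.pi / 2) (by
    rw [show ((3 * Real.pi / 2 : ℝ) : ℂ) * I = Real.pi * I + (Real.pi : ℂ) / 2 * I by
      push_cast; ring, Complex.exp_add, Complex.exp_pi_mul_I, Complex.exp_pi_div_two_mul_I]
    ring)
  have per : Function.Periodic H (2 * Real.pi) := by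
    intro θ
    have := periodic_circleMap 0 (√2 * d) θ
    simp only [hH, deriv_circleMap, this]
  have hcirc : ∮ z in C(0, √2 * d), G z =
      ∫ θ in (-(Real.pi / 4))..(-(Real.pi / 4) + 2 * Real.pi), H θ := by
    rw [← per.intervalIntegral_add_eq 0, zero_add]; rfl
  have hsplit : ∫ θ in (-(Real.pi / 4))..(-(Real.pi / 4) + 2 * Real.pi), H θ =
      (∫ θ in (-(Real.pi / 4) + (0:ℝ))..(Real.pi / 4 + 0), H θ) +
      (∫ θ in (-(Real.pi / 4) + Real.pi / 2)..(Real.pi / 4 + Real.pi / 2), H θ) +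
      (∫ θ in (-(Real.pi / 4) + Real.pi)..(Real.pi / 4 + Real.pi), H θ) +
      (∫ θ in (-(Real.pi / 4) + 3 * Real.pi / 2)..(Real.pi / 4 + 3 * Real.pi / 2), H θ) := by
    have ii : ∀ a b, IntervalIntegrable H MeasureTheory.volume a b :=
      fun a b => hHc.intervalIntegrable a b
    rw [show -(Real.pi / 4) + (0:ℝ) = -(Real.pi / 4) by ring,
      show Real.pi / 4 + (0:ℝ) = -(Real.pi / 4) + Real.pi / 2 by ring,
      show Real.pi / 4 + Real.pi / 2 = -(Real.pi / 4) + Real.pi by ring,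
      show Real.pi / 4 + Real.pi = -(Real.pi / 4) + 3 * Real.pi / 2 by ring,
      show Real.pi / 4 + 3 * Real.pi / 2 = -(Real.pi / 4) + 2 * Real.pi by ring,
      intervalIntegral.integral_add_adjacent_intervals (ii _ _) (ii _ _),
      intervalIntegral.integral_add_adjacent_intervals (ii _ _) (ii _ _),
      intervalIntegral.integral_add_adjacent_intervals (ii _ _) (ii _ _)]
  rw [hcirc, hsplit, ← r0, ← r1, ← r2, ← r3]
  have s1 : ∫ y in (-d)..d, G (I * (d + y * I)) = ∫ x in (-d)..d, G (x + d * I) := by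
    have := intervalIntegral.integral_comp_neg (a := -d) (b := d) (fun x : ℝ => G (x + d * I))
    rw [neg_neg] at this
    rw [← this]
    congr 1 with y
    congr 1
    push_cast
    linear_combination (y : ℂ) * Complex.I_mul_I
  have s2 : ∫ y in (-d)..d, G (-1 * (d + y * I)) = ∫ y in (-d)..d, G ((-d : ℝ) + y * I) := by
    have := intervalIntegral.integral_comp_neg (a := -d) (b := d)
      (fun y : ℝ => G ((-d : ℝ) + y * I))
    rw [neg_neg] at this
    rw [← this]
    congr 1 with y
    congr 1
    push_cast
    ring
  have s3 : ∫ y in (-d)..d, G (-I * (d + y * I)) = ∫ x in (-d)..d, G (x + (-d : ℝ) * I) := by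
    congr 1 with y
    congr 1
    push_cast
    linear_combination (-y : ℂ) * Complex.I_mul_I
  rw [s1, s2, s3, boxIntegral]
  simp only [one_mul]
  linear_combination (-(∫ x in (-d)..d, G (x + d * I)) +
    ∫ x in (-d)..d, G (x + (-d : ℝ) * I)) * Complex.I_mul_I

/-- The rectangle can be replaced by any circle around `0` of radius larger than one. -/
theorem rectIntegral_eq_circleIntegral {F : ℂ → ℂ}
    (hF : ∀ z ∈ cutComplement, DifferentiableAt ℂ F z)
    (hF0 : ContinuousOn F {z | 0 ≤ z.re}) {c r ρ : ℝ} (hc : 1 < c) (hr : 0 < r)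
    (hρ : 1 < ρ) :
    rectIntegral c r F = ∮ z in C(0, ρ), F z := by
  have hext : ∀ z : ℂ, 1 < ‖z‖ → DifferentiableAt ℂ F z :=
    fun z hz => hF z (mem_cutComplement_of_one_lt_norm hz)
  -- The square of half-side $d$ must contain the rectangle, and its circumscribed circle, of radius
  -- $\sqrt2\,d$, must have radius at least $\rho$.
  set d : ℝ := max (max c r) ρ with hd
  have hcd : c ≤ d := (le_max_left _ _).trans (le_max_left _ _)
  have hrd : r ≤ d := (le_max_right _ _).trans (le_max_left _ _)
  have hρd : ρ ≤ √2 * d := by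
    have : (1:ℝ) ≤ √2 := by rw [Real.le_sqrt' (by norm_num)]; norm_num
    have h2 : ρ ≤ d := le_max_right _ _
    nlinarith
  have h1 : rectIntegral c r F = boxIntegral F (-c) 0 (-r) r := by
    simp only [rectIntegral, boxIntegral]
    push_cast
    simp only [zero_add, neg_mul, ← sub_eq_add_neg]
    ring
  rw [h1, boxIntegral_eq_square hF hF0 hc hr hcd hrd,
    boxIntegral_square_eq_circleIntegral hext (by linarith)]
  refine Complex.circleIntegral_eq_of_differentiable_on_annulus_off_countable (by linarith) hρd
    Set.countable_empty ?_ ?_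
  · intro z hz
    refine (hext z ?_).continuousAt.continuousWithinAt
    have := hz.2
    simp only [Metric.mem_ball, dist_zero_right, not_lt] at this
    linarith
  · intro z hz
    refine hext z ?_
    have := hz.1.2
    simp only [Metric.mem_closedBall, dist_zero_right, not_le] at this
    linarith

/-! ### Borel transforms over circles -/

lemma differentiableAt_fAlpha (α : ℂ) {z : ℂ} (hz : z ∈ cutComplement) :
    DifferentiableAt ℂ (fAlpha α) z := by
  have h := ((differentiableAt_mul_log hz).const_mul α).cexp.const_sub (Complex.exp α)
  simp only [← mul_assoc] at h
  exact h

lemma continuousOn_fAlpha (α : ℂ) : ContinuousOn (fAlpha α) {z | 0 ≤ z.re} := by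
  have h : ContinuousOn (fun z => Complex.exp α - Complex.exp (α * (z * Complex.log (1 + 1 / z))))
      {z | 0 ≤ z.re} := continuousOn_const.sub (continuousOn_const.mul continuousOn_mul_log).cexp
  simp only [← mul_assoc] at h
  exact h

/-- The Cauchy integral `(2πi)⁻¹ ∮ G(z) e^{s z} dz` over the circle of radius `ρ` around `0`. -/
noncomputable def borelIntegral (ρ : ℝ) (G : ℂ → ℂ) (s : ℂ) : ℂ :=
  (2 * Real.pi * I)⁻¹ * ∮ z in C(0, ρ), G z * Complex.exp (s * z)

lemma phi_eq_borelIntegral {c r ρ : ℝ} (hc : 1 < c) (hr : 0 < r) (hρ : 1 < ρ) (α s : ℂ) :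
    phi c r α s = borelIntegral ρ (fAlpha α) s := by
  rw [phi, borelIntegral, one_div, rectIntegral_eq_circleIntegral _ _ hc hr hρ]
  · intro z hz
    exact (differentiableAt_fAlpha α hz).mul (by fun_prop)
  · exact (continuousOn_fAlpha α).mul (by fun_prop)

lemma continuousOn_fAlpha_sphere (α : ℂ) {ρ : ℝ} (hρ : 1 < ρ) :
    ContinuousOn (fAlpha α) (Metric.sphere 0 ρ) := fun z hz =>
  (differentiableAt_fAlpha α (mem_cutComplement_of_one_lt_norm
    (by rw [mem_sphere_zero_iff_norm.1 hz]; exact hρ))).continuousAt.continuousWithinAt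

lemma borelIntegral_const_mul (ρ : ℝ) (k : ℂ) (G : ℂ → ℂ) (s : ℂ) :
    borelIntegral ρ (fun z => k * G z) s = k * borelIntegral ρ G s := by
  have := circleIntegral.integral_const_mul k (fun z => G z * Complex.exp (s * z)) 0 ρ
  simp only [borelIntegral, mul_assoc] at this ⊢
  rw [this]; ring

lemma norm_borelIntegral_le {ρ : ℝ} (hρ : 0 ≤ ρ) {G : ℂ → ℂ} {C : ℝ} (s : ℂ)
    (h : ∀ z, ‖z‖ = ρ → ‖G z‖ ≤ C) :
    ‖borelIntegral ρ G s‖ ≤ ρ * (C * Real.exp (ρ * ‖s‖)) := by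
  have h1 := circleIntegral.norm_two_pi_i_inv_smul_integral_le_of_norm_le_const
    (f := fun z => G z * Complex.exp (s * z)) (c := 0) (R := ρ) (C := C * Real.exp (ρ * ‖s‖)) hρ
    (fun z hz => by
      have hz' := mem_sphere_zero_iff_norm.1 hz
      have hC : 0 ≤ C := (norm_nonneg _).trans (h z hz')
      rw [norm_mul, Complex.norm_exp]
      refine mul_le_mul (h z hz') (Real.exp_le_exp.2 ?_) (Real.exp_pos _).le hC
      calc (s * z).re ≤ ‖s * z‖ := Complex.re_le_norm _
        _ = ρ * ‖s‖ := by rw [norm_mul, hz', mul_comm])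
  simpa [borelIntegral, smul_eq_mul] using h1

lemma borelIntegral_sub {ρ : ℝ} (hρ : 0 ≤ ρ) {G H : ℂ → ℂ} (hG : ContinuousOn G (Metric.sphere 0 ρ))
    (hH : ContinuousOn H (Metric.sphere 0 ρ)) (s : ℂ) :
    borelIntegral ρ (fun z => G z - H z) s = borelIntegral ρ G s - borelIntegral ρ H s := by
  have e : Continuous (fun z => Complex.exp (s * z)) := by fun_prop
  rw [borelIntegral, borelIntegral, borelIntegral, ← mul_sub, ← circleIntegral.integral_sub]
  · simp only [sub_mul]
  · exact (hG.mul e.continuousOn).circleIntegrable hρ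
  · exact (hH.mul e.continuousOn).circleIntegrable hρ

/-- Uniform convergence of the kernels on the circle implies uniform convergence on compact sets. -/
lemma tendstoUniformlyOn_borelIntegral {ι : Type*} {l : Filter ι} {ρ : ℝ} (hρ : 0 < ρ)
    {G : ι → ℂ → ℂ} {H : ℂ → ℂ} (hG : ∀ᶠ i in l, ContinuousOn (G i) (Metric.sphere 0 ρ))
    (hH : ContinuousOn H (Metric.sphere 0 ρ))
    (h : TendstoUniformlyOn G H l (Metric.sphere 0 ρ)) {K : Set ℂ} (hK : IsCompact K) :
    TendstoUniformlyOn (fun i s => borelIntegral ρ (G i) s) (borelIntegral ρ H) l K := by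
  obtain ⟨S, hS⟩ := hK.isBounded.exists_norm_le
  rw [Metric.tendstoUniformlyOn_iff] at h ⊢
  intro ε hε
  set δ : ℝ := ε / (2 * (ρ * Real.exp (ρ * S))) with hδ
  have hδ0 : 0 < δ := by positivity
  filter_upwards [hG, h δ hδ0] with i hi hi2 s hs
  rw [dist_eq_norm, ← borelIntegral_sub hρ.le hH hi]
  have h1 := norm_borelIntegral_le hρ.le (G := fun z => H z - G i z) (C := δ) s (fun z hz => by
    rw [← dist_eq_norm]; exact (hi2 z (mem_sphere_zero_iff_norm.2 hz)).le)
  refine h1.trans_lt ?_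
  have h2 : Real.exp (ρ * ‖s‖) ≤ Real.exp (ρ * S) := by
    have := hS s hs
    gcongr
  calc ρ * (δ * Real.exp (ρ * ‖s‖)) ≤ ρ * (δ * Real.exp (ρ * S)) := by gcongr
    _ = ε / 2 := by rw [hδ]; field_simp
    _ < ε := by linarith

lemma borelIntegral_inv_pow {ρ : ℝ} (hρ : 0 < ρ) (n : ℕ) (s : ℂ) :
    borelIntegral ρ (fun z => 1 / z ^ (n + 1)) s = s ^ n / (n.factorial : ℂ) := by
  have h := DiffContOnCl.circleIntegral_one_div_sub_center_pow_smul (f := fun z => Complex.exp (s * z))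
    (c := 0) hρ n (Differentiable.diffContOnCl (by fun_prop))
  simp only [sub_zero, smul_eq_mul, iteratedDeriv_cexp_const_mul, mul_zero, Complex.exp_zero,
    mul_one] at h
  rw [borelIntegral, h]
  have : (2 * Real.pi * I : ℂ) ≠ 0 := by simp [Real.pi_ne_zero]
  field_simp

/-- Termwise integration of a Laurent expansion at infinity. -/
theorem hasSum_borelIntegral {ρ : ℝ} (hρ : 0 < ρ) {a : ℕ → ℂ} {G : ℂ → ℂ}
    (ha : Summable fun n => ‖a n‖ * (ρ⁻¹) ^ (n + 1))
    (hG : ∀ z, ‖z‖ = ρ → HasSum (fun n => a n * (1 / z ^ (n + 1))) (G z)) (s : ℂ) :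
    HasSum (fun n => a n * (s ^ n / (n.factorial : ℂ))) (borelIntegral ρ G s) := by
  have key : HasSum (fun n => ∮ z in C(0, ρ), a n * (1 / z ^ (n + 1)) * Complex.exp (s * z))
      (∮ z in C(0, ρ), G z * Complex.exp (s * z)) := by
    have hn : ∀ θ : ℝ, ‖circleMap 0 ρ θ‖ = ρ := fun θ => by
      rw [norm_circleMap_zero, abs_of_pos hρ]
    have hne : ∀ θ : ℝ, circleMap 0 ρ θ ≠ 0 := fun θ => by
      rw [← norm_pos_iff, hn]; exact hρ
    refine intervalIntegral.hasSum_integral_of_dominated_convergence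
      (fun n _ => ‖a n‖ * (ρ⁻¹) ^ (n + 1) * (ρ * Real.exp (ρ * ‖s‖))) ?_ ?_ ?_ ?_ ?_
    · intro n
      refine Continuous.aestronglyMeasurable ?_
      simp only [deriv_circleMap, smul_eq_mul]
      have : Continuous fun θ : ℝ => 1 / circleMap 0 ρ θ ^ (n + 1) := by
        refine continuous_const.div (by fun_prop) fun θ => pow_ne_zero _ (hne θ)
      fun_prop
    · intro n
      refine Eventually.of_forall fun θ _ => ?_
      rw [deriv_circleMap, norm_smul, norm_mul, norm_mul, norm_mul, hn, Complex.norm_I, mul_one,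
        norm_div, norm_pow, hn, norm_one, Complex.norm_exp, one_div, inv_pow]
      have : (s * circleMap 0 ρ θ).re ≤ ρ * ‖s‖ := by
        refine (Complex.re_le_norm _).trans ?_
        rw [norm_mul, hn, mul_comm]
      have : Real.exp (s * circleMap 0 ρ θ).re ≤ Real.exp (ρ * ‖s‖) := Real.exp_le_exp.2 this
      calc ρ * (‖a n‖ * (ρ ^ (n + 1))⁻¹ * Real.exp (s * circleMap 0 ρ θ).re)
          ≤ ρ * (‖a n‖ * (ρ ^ (n + 1))⁻¹ * Real.exp (ρ * ‖s‖)) := by gcongr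
        _ = _ := by ring
    · exact Eventually.of_forall fun θ _ => ha.mul_right _
    · exact intervalIntegrable_const
    · refine Eventually.of_forall fun θ _ => ?_
      exact ((hG _ (hn θ)).mul_right _).const_smul _
  have := key.mul_left (2 * Real.pi * I : ℂ)⁻¹
  refine this.congr_fun fun n => ?_
  rw [← borelIntegral_inv_pow hρ n s, ← borelIntegral_const_mul]
  rfl

/-! ### Holomorphy in both variables -/

lemma differentiable_integral_exp {u v w : ℝ → ℂ} (hu : Continuous u) (hv : Continuous v)
    (hw : Continuous w) (a b : ℝ) :
    Differentiable ℂ fun p : ℂ × ℂ => ∫ t in a..b, w t * Complex.exp (p.1 * u t + p.2 * v t) := by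
  intro p₀
  set F' : ℂ × ℂ → ℝ → (ℂ × ℂ →L[ℂ] ℂ) := fun p t =>
    (w t * Complex.exp (p.1 * u t + p.2 * v t)) •
      (u t • ContinuousLinearMap.fst ℂ ℂ ℂ + v t • ContinuousLinearMap.snd ℂ ℂ ℂ) with hF'
  have hF'c : Continuous fun q : (ℂ × ℂ) × ℝ => F' q.1 q.2 := by
    simp only [hF']; fun_prop
  obtain ⟨C, hC⟩ := ((isCompact_closedBall p₀ 1).prod (isCompact_uIcc (a := a) (b := b))).exists_bound_of_continuousOn
    hF'c.continuousOn
  refine (intervalIntegral.hasFDerivAt_integral_of_dominated_of_fderiv_le (F' := F')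
    (bound := fun _ => C) (Metric.ball_mem_nhds p₀ one_pos) ?_ ?_ ?_ ?_ ?_ ?_).differentiableAt
  · exact Eventually.of_forall fun p => (by fun_prop : Continuous fun t =>
      w t * Complex.exp (p.1 * u t + p.2 * v t)).aestronglyMeasurable
  · exact (by fun_prop : Continuous fun t =>
      w t * Complex.exp (p₀.1 * u t + p₀.2 * v t)).intervalIntegrable _ _
  · exact (hF'c.comp (by fun_prop : Continuous fun t : ℝ => (p₀, t))).aestronglyMeasurable
  · refine Eventually.of_forall fun t ht p hp => ?_
    exact hC (p, t) ⟨Metric.ball_subset_closedBall hp, Set.uIoc_subset_uIcc ht⟩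
  · exact intervalIntegrable_const
  · refine Eventually.of_forall fun t _ p _ => ?_
    have h1 : HasFDerivAt (fun p : ℂ × ℂ => p.1 * u t + p.2 * v t)
        (u t • ContinuousLinearMap.fst ℂ ℂ ℂ + v t • ContinuousLinearMap.snd ℂ ℂ ℂ) p :=
      ((ContinuousLinearMap.fst ℂ ℂ ℂ).hasFDerivAt.mul_const _).add
        ((ContinuousLinearMap.snd ℂ ℂ ℂ).hasFDerivAt.mul_const _)
    have h2 := h1.cexp.const_mul (w t)
    simpa only [hF', mul_smul] using h2

/-- On the circle of radius 2 the integrand is a difference of two exponentials whose exponents are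
linear in $(\alpha,s)$, so differentiation under the integral applies to each. -/
theorem differentiable_phi {c r : ℝ} (hc : 1 < c) (hr : 0 < r) :
    Differentiable ℂ (fun p : ℂ × ℂ => phi c r p.1 p.2) := by
  have hn : ∀ θ : ℝ, ‖circleMap 0 2 θ‖ = 2 := fun θ => by
    rw [norm_circleMap_zero, abs_of_pos two_pos]
  have hu : Continuous fun θ : ℝ => circleMap 0 2 θ * Complex.log (1 + 1 / circleMap 0 2 θ) := by
    refine continuous_iff_continuousAt.2 fun θ => ?_
    refine ContinuousAt.comp (f := circleMap 0 2) (differentiableAt_mul_log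
      (mem_cutComplement_of_one_lt_norm ?_)).continuousAt (continuous_circleMap _ _).continuousAt
    rw [hn]; norm_num
  have hv := continuous_circleMap 0 2
  have hw : Continuous fun θ : ℝ => circleMap 0 2 θ * I := by fun_prop
  have h1 := differentiable_integral_exp (continuous_const (y := (1:ℂ))) hv hw 0 (2 * Real.pi)
  have h2 := differentiable_integral_exp hu hv hw 0 (2 * Real.pi)
  have : (fun p : ℂ × ℂ => phi c r p.1 p.2) = fun p : ℂ × ℂ => (2 * Real.pi * I : ℂ)⁻¹ *
      ((∫ θ in 0..(2 * Real.pi), circleMap 0 2 θ * I *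
        Complex.exp (p.1 * 1 + p.2 * circleMap 0 2 θ)) -
      ∫ θ in 0..(2 * Real.pi), circleMap 0 2 θ * I * Complex.exp (p.1 * (circleMap 0 2 θ *
        Complex.log (1 + 1 / circleMap 0 2 θ)) + p.2 * circleMap 0 2 θ)) := by
    funext p
    rw [phi_eq_borelIntegral hc hr one_lt_two, borelIntegral, circleIntegral,
      ← intervalIntegral.integral_sub]
    · congr 2 with θ
      simp only [deriv_circleMap, smul_eq_mul, fAlpha, Complex.exp_add, mul_one, ← mul_assoc]
      ring
    · exact Continuous.intervalIntegrable (by fun_prop) _ _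
    · exact Continuous.intervalIntegrable (by fun_prop) _ _
  rw [this]
  exact (h1.sub h2).const_mul _

lemma differentiable_phi_right {c r : ℝ} (hc : 1 < c) (hr : 0 < r) (α : ℂ) :
    Differentiable ℂ (phi c r α) :=
  (differentiable_phi hc hr).comp (g := fun p : ℂ × ℂ => phi c r p.1 p.2) (f := fun s => (α, s))
    (by fun_prop)

/-! ### The limit $\alpha\to0$ -/

lemma hasSum_limitW (s : ℂ) :
    HasSum (fun n : ℕ => (-1) ^ n / ((n : ℂ) + 2) * (s ^ n / (n.factorial : ℂ))) (limitW s) := by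
  rcases eq_or_ne s 0 with rfl | hs
  · have h := hasSum_single (f := fun n : ℕ => (-1) ^ n / ((n : ℂ) + 2) *
      ((0 : ℂ) ^ n / (n.factorial : ℂ))) 0 (by
        intro n hn
        simp [hn])
    simpa [limitW] using h
  · have h1 : HasSum (fun n : ℕ => (-s) ^ n / (n.factorial : ℂ)) (Complex.exp (-s)) := by
      have := NormedSpace.expSeries_div_hasSum_exp (-s)
      rwa [← Complex.exp_eq_exp_ℂ] at this
    have h2 : HasSum (fun n : ℕ => (-s) ^ (n + 1) / ((n + 1).factorial : ℂ))
        (Complex.exp (-s) - 1) := by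
      have := (hasSum_nat_add_iff' 1).2 h1
      simpa using this
    have h3 : HasSum (fun n : ℕ => (-s) ^ (n + 2) / ((n + 2).factorial : ℂ))
        (Complex.exp (-s) - (1 - s)) := by
      have := (hasSum_nat_add_iff' 2).2 h1
      simpa [Finset.sum_range_succ, sub_eq_add_neg] using this
    have h4 := ((h2.mul_left (-s)).sub h3).div_const (s ^ 2)
    -- Combining the two exponential tails yields the coefficient $1/(n+1)!-1/(n+2)!=1/((n+2)\,n!)$.
    have e : (-s * (Complex.exp (-s) - 1) - (Complex.exp (-s) - (1 - s))) / s ^ 2 = limitW s := by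
      rw [limitW, if_neg hs]
      congr 1; ring
    rw [e] at h4
    refine h4.congr_fun fun n => ?_
    have f0 : (n.factorial : ℂ) ≠ 0 := by exact_mod_cast n.factorial_ne_zero
    have f1 : ((n : ℂ) + 1) ≠ 0 := by exact_mod_cast n.succ_ne_zero
    have f2 : ((n : ℂ) + 2) ≠ 0 := by exact_mod_cast (n + 1).succ_ne_zero
    rw [Nat.factorial_succ (n + 1), Nat.factorial_succ n]
    push_cast
    rw [show ((n : ℂ) + 1 + 1) = n + 2 by ring, neg_pow s (n + 1), neg_pow s (n + 2)]
    field_simp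
    ring

lemma hasSum_one_sub_mul_log {z : ℂ} (hz : 1 < ‖z‖) :
    HasSum (fun n : ℕ => (-1) ^ n / ((n : ℂ) + 2) * (1 / z ^ (n + 1)))
      (1 - z * Complex.log (1 + 1 / z)) := by
  have hz0 : z ≠ 0 := by rintro rfl; simp at hz; linarith
  have ht : ‖1 / z‖ < 1 := by
    rw [norm_div, norm_one, div_lt_one (by linarith)]; exact hz
  have h := (hasSum_nat_add_iff' 2).2 (Complex.hasSum_taylorSeries_log ht)
  have h2 := h.mul_left (-z)
  simp only [Finset.sum_range_succ, Finset.sum_range_zero] at h2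
  have e : -z * (Complex.log (1 + 1 / z) - (0 + (-1) ^ (0 + 1) * (1 / z) ^ 0 / ((0 : ℕ) : ℂ) +
      (-1) ^ (1 + 1) * (1 / z) ^ 1 / ((1 : ℕ) : ℂ))) = 1 - z * Complex.log (1 + 1 / z) := by
    -- The Taylor term of index $0$ has denominator $0$ and therefore equals $0$.
    simp only [Nat.cast_zero, div_zero, Nat.cast_one]
    field_simp
    ring
  rw [e] at h2
  refine h2.congr_fun fun n => ?_
  have f2 : ((n : ℂ) + 2) ≠ 0 := by exact_mod_cast (n + 1).succ_ne_zero
  push_cast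
  rw [div_pow, one_pow]
  field_simp
  ring

lemma limitW_eq_borelIntegral :
    limitW = borelIntegral 2 (fun z => 1 - z * Complex.log (1 + 1 / z)) := by
  funext s
  refine (hasSum_limitW s).unique (hasSum_borelIntegral two_pos ?_ (fun z hz =>
    hasSum_one_sub_mul_log (by rw [hz]; norm_num)) s)
  have hg : Summable fun n : ℕ => ((2 : ℝ)⁻¹) ^ (n + 1) :=
    (summable_nat_add_iff 1).2 (summable_geometric_of_lt_one (by norm_num) (by norm_num))
  refine hg.of_nonneg_of_le (fun n => by positivity) fun n => ?_
  have : ‖(-1 : ℂ) ^ n / ((n : ℂ) + 2)‖ ≤ 1 := by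
    rw [norm_div, norm_pow, norm_neg, norm_one, one_pow]
    have : ‖(n : ℂ) + 2‖ = n + 2 := by
      rw [show (n : ℂ) + 2 = ((n + 2 : ℕ) : ℂ) by push_cast; ring, Complex.norm_natCast]
      push_cast; ring
    rw [this, div_le_one (by positivity)]
    linarith [(Nat.cast_nonneg n : (0:ℝ) ≤ n)]
  calc _ ≤ 1 * ((2 : ℝ)⁻¹) ^ (n + 1) := by gcongr
    _ = _ := one_mul _

lemma continuousOn_mul_log_sphere {ρ : ℝ} (hρ : 1 < ρ) :
    ContinuousOn (fun z : ℂ => z * Complex.log (1 + 1 / z)) (Metric.sphere 0 ρ) := fun z hz =>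
  (differentiableAt_mul_log (mem_cutComplement_of_one_lt_norm
    (by rw [mem_sphere_zero_iff_norm.1 hz]; exact hρ))).continuousAt.continuousWithinAt

lemma fAlpha_div (α z : ℂ) : fAlpha α z / Complex.exp α =
    1 - Complex.exp (α * (z * Complex.log (1 + 1 / z) - 1)) := by
  rw [fAlpha, sub_div, div_self (Complex.exp_ne_zero _), ← Complex.exp_sub]
  congr 2; ring

/-- With $q=z\,\mathrm{Log}(1+1/z)-1$ bounded on $|z|=2$, the normalised kernel is $(1-e^{\alpha
q})/\alpha=-q+O(|\alpha||q|^2)$, uniformly on the circle. -/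
theorem tendstoUniformlyOn_phi_zero {c r : ℝ} (hc : 1 < c) (hr : 0 < r) {K : Set ℂ}
    (hK : IsCompact K) :
    TendstoUniformlyOn (fun α s => phi c r α s / (α * Complex.exp α)) limitW (𝓝[≠] 0) K := by
  have e : (fun α s => phi c r α s / (α * Complex.exp α)) = fun α s =>
      borelIntegral 2 (fun z => (α * Complex.exp α)⁻¹ * fAlpha α z) s := by
    funext α s
    rw [borelIntegral_const_mul, phi_eq_borelIntegral hc hr one_lt_two, div_eq_inv_mul]
  have hL := continuousOn_mul_log_sphere one_lt_two
  rw [e, limitW_eq_borelIntegral]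
  refine tendstoUniformlyOn_borelIntegral two_pos (Eventually.of_forall fun α =>
    continuousOn_const.mul (continuousOn_fAlpha_sphere α one_lt_two)) (continuousOn_const.sub hL)
    ?_ hK
  obtain ⟨C, hC⟩ := (isCompact_sphere (0 : ℂ) 2).exists_bound_of_continuousOn
    (hL.sub (continuousOn_const (c := (1 : ℂ))))
  have hC0 : 0 ≤ C := (norm_nonneg _).trans (hC 2 (by simp))
  rw [Metric.tendstoUniformlyOn_iff]
  intro ε hε
  have hev : ∀ᶠ α : ℂ in 𝓝[≠] 0, ‖α‖ * C < 1 ∧ ‖α‖ * C ^ 2 < ε := by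
    refine eventually_nhdsWithin_of_eventually_nhds ?_
    have h1 : Tendsto (fun α : ℂ => ‖α‖ * C) (𝓝 0) (𝓝 0) := by
      have : Continuous fun α : ℂ => ‖α‖ * C := by fun_prop
      simpa using this.tendsto 0
    have h2 : Tendsto (fun α : ℂ => ‖α‖ * C ^ 2) (𝓝 0) (𝓝 0) := by
      have : Continuous fun α : ℂ => ‖α‖ * C ^ 2 := by fun_prop
      simpa using this.tendsto 0
    exact (h1.eventually_lt_const one_pos).and (h2.eventually_lt_const hε)
  filter_upwards [hev, self_mem_nhdsWithin] with α hα hα0 z hz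
  have hα0 : α ≠ 0 := hα0
  have hα' : 0 < ‖α‖ := norm_pos_iff.2 hα0
  set q : ℂ := z * Complex.log (1 + 1 / z) - 1 with hq
  have hqC : ‖q‖ ≤ C := hC z hz
  have e1 : (α * Complex.exp α)⁻¹ * fAlpha α z = (1 - Complex.exp (α * q)) / α := by
    rw [← fAlpha_div]
    field_simp [Complex.exp_ne_zero]
  have e2 : (1 - z * Complex.log (1 + 1 / z)) - (1 - Complex.exp (α * q)) / α =
      (Complex.exp (α * q) - 1 - α * q) / α := by
    rw [show 1 - z * Complex.log (1 + 1 / z) = -q by rw [hq]; ring]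
    field_simp
    ring
  change dist (1 - z * Complex.log (1 + 1 / z)) ((α * Complex.exp α)⁻¹ * fAlpha α z) < ε
  rw [dist_eq_norm, e1, e2, norm_div]
  have hαq : ‖α * q‖ ≤ 1 := by
    rw [norm_mul]
    exact (mul_le_mul_of_nonneg_left hqC hα'.le).trans hα.1.le
  have h3 := Complex.norm_exp_sub_one_sub_id_le hαq
  rw [div_lt_iff₀ hα']
  refine h3.trans_lt ?_
  rw [norm_mul, mul_pow]
  have : ‖q‖ ^ 2 ≤ C ^ 2 := by gcongr
  nlinarith

/-! ### The limit $|\alpha|\to\infty$ -/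

lemma circleIntegral_scale (α : ℂ) (R : ℝ) (H : ℂ → ℂ) :
    ∮ z in C(0, ‖α‖ * R), H z = α * ∮ u in C(0, R), H (α * u) := by
  set τ : ℝ := α.arg
  have hτ : (‖α‖ : ℂ) * Complex.exp (τ * I) = α := Complex.norm_mul_exp_arg_mul_I α
  have hm : ∀ θ : ℝ, circleMap 0 (‖α‖ * R) (θ + τ) = α * circleMap 0 R θ := by
    intro θ
    simp only [circleMap, zero_add]
    push_cast
    rw [add_mul, Complex.exp_add]
    linear_combination (R * Complex.exp (θ * I)) * hτ
  set g : ℝ → ℂ := fun θ => deriv (circleMap 0 (‖α‖ * R)) θ • H (circleMap 0 (‖α‖ * R) θ) with hg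
  have per : Function.Periodic g (2 * Real.pi) := by
    intro θ
    have := periodic_circleMap 0 (‖α‖ * R) θ
    simp only [hg, deriv_circleMap, this]
  have h1 : ∮ z in C(0, ‖α‖ * R), H z = ∫ θ in (0 + τ)..(2 * Real.pi + τ), g θ := by
    rw [show 2 * Real.pi + τ = (0 + τ) + 2 * Real.pi by ring,
      ← per.intervalIntegral_add_eq 0, zero_add]; rfl
  rw [h1, ← intervalIntegral.integral_comp_add_right, circleIntegral,
    ← intervalIntegral.integral_const_mul]
  congr 1 with θ
  simp only [hg, deriv_circleMap, smul_eq_mul, hm]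
  ring

/-- Since $|\alpha|>1$, the circle $|z|=|\alpha|$ is admissible. Substituting $z=\alpha u$ turns
$e^{(s/\alpha)z}$ into $e^{su}$, and $dz=\alpha\,du$ cancels the factor $\alpha$ in the denominator.
-/
lemma phi_div_eq_borelIntegral {c r : ℝ} (hc : 1 < c) (hr : 0 < r) {α : ℂ} (hα : 1 < ‖α‖) (s : ℂ) :
    phi c r α (s / α) / (α * Complex.exp α) =
      borelIntegral 1 (fun u => 1 - Complex.exp (α *
        ((α * u) * Complex.log (1 + 1 / (α * u)) - 1))) s := by
  have hα0 : α ≠ 0 := by rintro rfl; simp at hα; linarith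
  rw [phi_eq_borelIntegral hc hr hα, borelIntegral,
    show ‖α‖ = ‖α‖ * 1 by ring, circleIntegral_scale]
  simp only [← fAlpha_div]
  simp only [div_eq_inv_mul _ (Complex.exp α)]
  rw [borelIntegral_const_mul, borelIntegral]
  have : ∀ u : ℂ, s / α * (α * u) = s * u := fun u => by field_simp
  simp only [this]
  field_simp
  simp only [mul_comm s]

lemma hasSum_one_sub_exp {u : ℂ} (hu : u ≠ 0) :
    HasSum (fun n : ℕ => -((-1 / 2) ^ (n + 1) / ((n + 1).factorial : ℂ)) * (1 / u ^ (n + 1)))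
      (1 - Complex.exp (-1 / (2 * u))) := by
  have h1 : HasSum (fun n : ℕ => (-1 / (2 * u)) ^ n / (n.factorial : ℂ))
      (Complex.exp (-1 / (2 * u))) := by
    have := NormedSpace.expSeries_div_hasSum_exp (-1 / (2 * u))
    rwa [← Complex.exp_eq_exp_ℂ] at this
  have h2 := ((hasSum_nat_add_iff' 1).2 h1).neg
  simp only [Finset.sum_range_one, pow_zero, Nat.factorial_zero, Nat.cast_one, div_one,
    neg_sub] at h2
  refine h2.congr_fun fun n => ?_
  rw [show (-1 / (2 * u)) = (-1 / 2) * (1 / u) by field_simp, mul_pow, div_pow 1 u, one_pow]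
  ring

/-- The exponential series supplies the factor $1/(n+1)!$ and the Borel transform the factor $1/n!$;
together they are the Bessel coefficients. -/
lemma hasSum_borelIntegral_one_sub_exp (s : ℂ) :
    HasSum (fun n : ℕ => 1 / 2 * ((-1) ^ n * (s / 2) ^ n /
      ((n.factorial : ℂ) * ((n + 1).factorial : ℂ))))
      (borelIntegral 1 (fun u => 1 - Complex.exp (-1 / (2 * u))) s) := by
  have h := hasSum_borelIntegral one_pos (a := fun n : ℕ => -((-1 / 2) ^ (n + 1) /
    ((n + 1).factorial : ℂ))) (G := fun u => 1 - Complex.exp (-1 / (2 * u))) (by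
      have := (summable_nat_add_iff 1).2 (Real.summable_pow_div_factorial (1 / 2))
      refine this.congr fun n => ?_
      simp) (fun u hu => hasSum_one_sub_exp (by rintro rfl; simp at hu)) s
  refine h.congr_fun fun n => ?_
  rw [pow_succ, div_pow, div_pow]
  have f0 : (n.factorial : ℂ) ≠ 0 := by exact_mod_cast n.factorial_ne_zero
  have f1 : ((n + 1).factorial : ℂ) ≠ 0 := by exact_mod_cast (n + 1).factorial_ne_zero
  field_simp

lemma besselJ1_eq (z : ℂ) :
    besselJ1 z = z * borelIntegral 1 (fun u => 1 - Complex.exp (-1 / (2 * u))) (z ^ 2 / 2) := by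
  rw [← (hasSum_borelIntegral_one_sub_exp (z ^ 2 / 2)).tsum_eq, tsum_mul_left, besselJ1]
  have : ∀ n : ℕ, (z ^ 2 / 2 / 2) ^ n = (z / 2) ^ (2 * n) := by
    intro n
    rw [pow_mul]; congr 1; ring
  simp only [this]
  ring

lemma besselLimit_eq_borelIntegral :
    besselLimit = borelIntegral 1 (fun u => 1 - Complex.exp (-1 / (2 * u))) := by
  funext s
  rw [besselLimit]
  split_ifs with hs
  · subst hs
    have h := hasSum_single (f := fun n : ℕ => 1 / 2 * ((-1) ^ n * ((0 : ℂ) / 2) ^ n /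
      ((n.factorial : ℂ) * ((n + 1).factorial : ℂ)))) 0 (by
        intro n hn
        simp [hn])
    have h2 := h.unique (hasSum_borelIntegral_one_sub_exp 0)
    rw [← h2]
    simp
  · have hq : Complex.sqrt (2 * s) ^ 2 = 2 * s := by
      simp [Complex.sqrt]
    have hq0 : Complex.sqrt (2 * s) ≠ 0 := by
      intro h; rw [h] at hq; simp at hq; exact hs hq
    rw [besselJ1_eq, hq, mul_div_cancel_left₀ _ hq0]
    congr 1; ring

lemma hasSum_besselLimit (s : ℂ) :
    HasSum (fun n : ℕ => 1 / 2 * ((-1) ^ n * (s / 2) ^ n /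
      ((n.factorial : ℂ) * ((n + 1).factorial : ℂ)))) (besselLimit s) := by
  rw [besselLimit_eq_borelIntegral]
  exact hasSum_borelIntegral_one_sub_exp s

lemma besselJ1_eq_mul_besselLimit (z : ℂ) : besselJ1 z = z * besselLimit (z ^ 2 / 2) := by
  rw [besselLimit_eq_borelIntegral, besselJ1_eq]

/-- Expand $\mathrm{Log}(1+t)$ at $t=1/(\alpha u)$ to second order: the linear term cancels the
$-1$, the quadratic term gives $-1/(2u)$, and the remainder is at most $|\alpha|^2|t|^3$. -/
lemma norm_mul_log_sub_le {α u : ℂ} (hα : 2 ≤ ‖α‖) (hu : ‖u‖ = 1) :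
    ‖α * ((α * u) * Complex.log (1 + 1 / (α * u)) - 1) - -1 / (2 * u)‖ ≤ 1 / ‖α‖ := by
  have hα0 : α ≠ 0 := by rintro rfl; simp at hα; linarith
  have hαp : 0 < ‖α‖ := by linarith
  have hu0 : u ≠ 0 := by rintro rfl; simp at hu
  set t : ℂ := 1 / (α * u) with ht
  have htn : ‖t‖ = 1 / ‖α‖ := by rw [ht, norm_div, norm_mul, hu, norm_one, mul_one]
  have ht2 : ‖t‖ ≤ 1 / 2 := by rw [htn]; gcongr
  have h := Complex.norm_log_sub_logTaylor_le 2 (z := t) (by linarith)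
  have hT : logTaylor (2 + 1) t = t - t ^ 2 / 2 := by
    simp [logTaylor_succ, logTaylor_zero]; ring
  rw [hT] at h
  have e : α * ((α * u) * Complex.log (1 + t) - 1) - -1 / (2 * u) =
      α * (α * u) * (Complex.log (1 + t) - (t - t ^ 2 / 2)) := by
    rw [ht]; field_simp; ring
  rw [e, norm_mul, norm_mul, norm_mul, hu, mul_one]
  have h5 : (1 - ‖t‖)⁻¹ ≤ 2 := by
    rw [inv_le_comm₀ (by linarith) two_pos]; linarith
  have h6 : ‖t‖ ^ (2 + 1) * (1 - ‖t‖)⁻¹ / (((2 : ℕ) : ℝ) + 1) ≤ ‖t‖ ^ 3 := by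
    have : ‖t‖ ^ (2 + 1) * (1 - ‖t‖)⁻¹ ≤ ‖t‖ ^ 3 * 2 := by gcongr
    have h3 : 0 ≤ ‖t‖ ^ 3 := by positivity
    rw [div_le_iff₀ (by norm_num)]
    push_cast
    linarith
  calc ‖α‖ * ‖α‖ * ‖Complex.log (1 + t) - (t - t ^ 2 / 2)‖ ≤ ‖α‖ * ‖α‖ * ‖t‖ ^ 3 := by
        have := h.trans h6
        gcongr
    _ = 1 / ‖α‖ := by rw [htn]; field_simp

theorem tendstoUniformlyOn_phi_cobounded {c r : ℝ} (hc : 1 < c) (hr : 0 < r) {K : Set ℂ}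
    (hK : IsCompact K) :
    TendstoUniformlyOn (fun α s => phi c r α (s / α) / (α * Complex.exp α)) besselLimit
      (Bornology.cobounded ℂ) K := by
  have hlarge : ∀ M : ℝ, ∀ᶠ α : ℂ in Bornology.cobounded ℂ, M < ‖α‖ := fun M =>
    tendsto_norm_cobounded_atTop.eventually_gt_atTop M
  rw [besselLimit_eq_borelIntegral]
  refine (tendstoUniformlyOn_borelIntegral (l := Bornology.cobounded ℂ) one_pos
    (G := fun α u => 1 - Complex.exp (α * ((α * u) * Complex.log (1 + 1 / (α * u)) - 1)))
    (H := fun u => 1 - Complex.exp (-1 / (2 * u))) ?_ ?_ ?_ hK).congr ?_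
  · filter_upwards [hlarge 1] with α hα
    intro u hu
    have hd : DifferentiableAt ℂ (fun z : ℂ => z * Complex.log (1 + 1 / z)) (α * u) :=
      differentiableAt_mul_log (mem_cutComplement_of_one_lt_norm
        (by rw [norm_mul, mem_sphere_zero_iff_norm.1 hu, mul_one]; exact hα))
    have hd2 : ContinuousAt (fun u : ℂ => (α * u) * Complex.log (1 + 1 / (α * u))) u :=
      ContinuousAt.comp (f := fun u : ℂ => α * u) hd.continuousAt (by fun_prop)
    exact ContinuousAt.continuousWithinAt (by fun_prop)
  · refine continuousOn_const.sub (ContinuousOn.cexp ?_)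
    refine continuousOn_const.div (by fun_prop) ?_
    intro u hu
    have := mem_sphere_zero_iff_norm.1 hu
    have : u ≠ 0 := by rintro rfl; simp at this
    simpa using this
  · rw [Metric.tendstoUniformlyOn_iff]
    intro ε hε
    filter_upwards [hlarge 2, hlarge (2 * Real.exp 1 / ε)] with α h2 hα u hu
    have hu := mem_sphere_zero_iff_norm.1 hu
    have hαp : 0 < ‖α‖ := by linarith
    set q : ℂ := α * ((α * u) * Complex.log (1 + 1 / (α * u)) - 1)
    set q₀ : ℂ := -1 / (2 * u) with hq₀
    have hb : ‖q - q₀‖ ≤ 1 / ‖α‖ := norm_mul_log_sub_le h2.le hu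
    have hb1 : ‖q - q₀‖ ≤ 1 := hb.trans (by rw [div_le_one hαp]; linarith)
    have e : (1 - Complex.exp q₀) - (1 - Complex.exp q) =
        Complex.exp q₀ * (Complex.exp (q - q₀) - 1) := by
      rw [mul_sub, ← Complex.exp_add]; simp
    have h3 := Complex.norm_exp_sub_one_le hb1
    have h4 : ‖Complex.exp q₀‖ ≤ Real.exp 1 := by
      rw [Complex.norm_exp, Real.exp_le_exp]
      refine (Complex.re_le_norm _).trans ?_
      rw [hq₀, norm_div, norm_mul, hu, norm_neg, norm_one]; norm_num
    rw [dist_eq_norm, e, norm_mul]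
    calc ‖Complex.exp q₀‖ * ‖Complex.exp (q - q₀) - 1‖ ≤ Real.exp 1 * (2 * (1 / ‖α‖)) := by
          gcongr; exact h3.trans (by linarith)
      _ = (2 * Real.exp 1) / ‖α‖ := by ring
      _ < ε := by rwa [div_lt_comm₀ hαp hε]
  · filter_upwards [hlarge 1] with α hα s _
    exact (phi_div_eq_borelIntegral hc hr hα s).symm

/-! ### The zeros of $w$ and the Lambert branches -/

lemma limitW_eq_zero_iff (s : ℂ) : limitW s = 0 ↔ s ≠ 0 ∧ Complex.exp s = 1 + s := by
  rw [limitW]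
  split_ifs with h
  · simp [h]
  · have hs : s ^ 2 ≠ 0 := pow_ne_zero _ h
    rw [div_eq_zero_iff, or_iff_left hs, Complex.exp_neg, sub_eq_zero]
    have he := Complex.exp_ne_zero s
    constructor
    · intro h1
      refine ⟨h, ?_⟩
      field_simp at h1
      exact h1
    · rintro ⟨-, h1⟩
      rw [← h1, mul_inv_cancel₀ he]

lemma limitW_ofReal_ne_zero (x : ℝ) : limitW (x : ℂ) ≠ 0 := by
  intro h
  obtain ⟨h0, h1⟩ := (limitW_eq_zero_iff _).1 h
  have hx : x ≠ 0 := by exact_mod_cast h0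
  have h2 : Real.exp x = 1 + x := by exact_mod_cast h1
  have := Real.add_one_lt_exp hx
  linarith

/-- The logarithmic form of `w e^w = -1/e` on the `k`-th branch. -/
def IsLambertSol (k : ℤ) (w : ℂ) : Prop :=
  w.im ≠ 0 ∧ w + Complex.log w = -1 + (2 * k + 1) * Real.pi * I

lemma exists_int_log {w : ℂ} (hw : w * Complex.exp w = -1 / Complex.exp 1) :
    ∃ n : ℤ, w + Complex.log w = -1 + (2 * n + 1) * Real.pi * I := by
  have hw0 : w ≠ 0 := by
    rintro rfl
    rw [zero_mul, eq_comm] at hw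
    exact div_ne_zero (neg_ne_zero.2 one_ne_zero) (Complex.exp_ne_zero 1) hw
  have h : Complex.exp (w + Complex.log w) = Complex.exp (-1 + Real.pi * I) := by
    rw [Complex.exp_add, Complex.exp_log hw0, Complex.exp_add, Complex.exp_pi_mul_I,
      Complex.exp_neg, mul_comm, hw]
    field_simp
  obtain ⟨n, hn⟩ := Complex.exp_eq_exp_iff_exists_int.1 h
  exact ⟨n, by rw [hn]; ring⟩

lemma mul_exp_of_log {n : ℤ} {w : ℂ} (hw0 : w ≠ 0)
    (h : w + Complex.log w = -1 + (2 * n + 1) * Real.pi * I) :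
    w * Complex.exp w = -1 / Complex.exp 1 := by
  have h2 : Complex.exp (w + Complex.log w) = Complex.exp (-1 + Real.pi * I) :=
    Complex.exp_eq_exp_iff_exists_int.2 ⟨n, by rw [h]; ring⟩
  rw [Complex.exp_add, Complex.exp_log hw0, Complex.exp_add, Complex.exp_pi_mul_I,
      Complex.exp_neg, mul_comm] at h2
  rw [h2]
  field_simp

lemma im_add_arg_of_log {n : ℤ} {w : ℂ} (h : w + Complex.log w = -1 + (2 * n + 1) * Real.pi * I) :
    w.im + w.arg = (2 * n + 1) * Real.pi := by
  have := congrArg Complex.im h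
  simpa [Complex.log_im] using this

lemma re_add_log_norm_of_log {n : ℤ} {w : ℂ}
    (h : w + Complex.log w = -1 + (2 * n + 1) * Real.pi * I) :
    w.re + Real.log ‖w‖ = -1 := by
  have := congrArg Complex.re h
  simpa [Complex.log_re] using this

/-- Taking imaginary parts, a solution has $\mathrm{Im}\,w+\mathrm{Arg}\,w=(2n+1)\pi$, and the
half-open strip of width $2\pi$ forces $n=k$. A real $w$ would give $(2n+1)\pi\in(-\pi,\pi]$, hence
$n=0$, which is excluded. -/
lemma mem_lambertRange_and_iff {k : ℤ} (hk : k ≠ -1) (hk0 : k ≠ 0) (w : ℂ) :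
    (w ∈ lambertRange k ∧ w * Complex.exp w = -1 / Complex.exp 1) ↔ IsLambertSol k w := by
  have hpi := Real.pi_pos
  constructor
  · rintro ⟨h1, h2⟩
    obtain ⟨n, hn⟩ := exists_int_log h2
    have hi := im_add_arg_of_log hn
    rcases h1 with ⟨-, -, h | h⟩ | ⟨-, h3, h4⟩
    · exact absurd h hk
    · exact absurd h.1 hk0
    · rw [hi] at h3 h4
      have h5 := lt_of_mul_lt_mul_right h3 hpi.le
      have h6 := le_of_mul_le_mul_right h4 hpi
      have hnk : n = k := by
        have h5' : (2 * k - 1 : ℤ) < 2 * n + 1 := by exact_mod_cast h5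
        have h6' : (2 * n + 1 : ℤ) ≤ 2 * k + 1 := by exact_mod_cast h6
        omega
      subst hnk
      refine ⟨fun him => ?_, hn⟩
      rw [him, zero_add] at hi
      have h7 := Complex.neg_pi_lt_arg w
      have h8 := Complex.arg_le_pi w
      rw [hi] at h7 h8
      have h9 : (-1 : ℝ) < 2 * n + 1 := lt_of_mul_lt_mul_right (by linarith) hpi.le
      have h10 : (2 * n + 1 : ℝ) ≤ 1 := le_of_mul_le_mul_right (by linarith) hpi
      have h9' : (-1 : ℤ) < 2 * n + 1 := by exact_mod_cast h9
      have h10' : (2 * n + 1 : ℤ) ≤ 1 := by exact_mod_cast h10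
      omega
  · rintro ⟨him, h⟩
    have hw0 : w ≠ 0 := by rintro rfl; simp at him
    refine ⟨Or.inr ⟨fun h' => him h'.1, ?_, ?_⟩, mul_exp_of_log hw0 h⟩
    · rw [im_add_arg_of_log h]; nlinarith
    · rw [im_add_arg_of_log h]

lemma IsLambertSol.conj {k : ℤ} {w : ℂ} (h : IsLambertSol k w) :
    IsLambertSol (-1 - k) ((starRingEnd ℂ) w) := by
  obtain ⟨him, h⟩ := h
  refine ⟨by simpa using him, ?_⟩
  have harg : w.arg ≠ Real.pi := fun h' => him (Complex.arg_eq_pi_iff.1 h').2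
  rw [Complex.log_conj _ harg, ← map_add, h]
  simp only [map_add, map_neg, map_one, map_mul, map_ofNat, Complex.conj_ofReal, Complex.conj_I,
    map_intCast]
  push_cast
  ring

/-- Since $\mathrm{Arg}\,w\le\pi$, the imaginary part is at least $2k\pi$. This places solutions in
the half-plane where the logarithm is a contraction. -/
lemma IsLambertSol.two_pi_le_im {k : ℤ} (hk : 1 ≤ k) {w : ℂ} (h : IsLambertSol k w) :
    2 * Real.pi ≤ w.im := by
  have h1 := im_add_arg_of_log h.2
  have h2 := Complex.arg_le_pi w
  have h3 : (1 : ℝ) ≤ k := by exact_mod_cast hk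
  nlinarith [Real.pi_pos]

lemma norm_log_sub_log_le {v w : ℂ} (hv : 2 * Real.pi ≤ v.im) (hw : 2 * Real.pi ≤ w.im) :
    ‖Complex.log v - Complex.log w‖ ≤ 1 / 6 * ‖v - w‖ := by
  have hpi := Real.pi_gt_three
  have hconv : Convex ℝ {z : ℂ | 2 * Real.pi ≤ z.im} := convex_halfSpace_im_ge _
  refine hconv.norm_image_sub_le_of_norm_hasDerivWithin_le (f' := fun z => z⁻¹) ?_ ?_ hw hv
  · intro z hz
    have hz : 2 * Real.pi ≤ z.im := hz
    refine (Complex.hasDerivAt_log (mem_slitPlane_iff.2 (Or.inr ?_))).hasDerivWithinAt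
    linarith
  · intro z hz
    have hz : 2 * Real.pi ≤ z.im := hz
    have : 6 ≤ ‖z‖ := by
      have := Complex.abs_im_le_norm z
      have := le_abs_self z.im
      linarith
    rw [norm_inv, one_div]
    gcongr

/-- The residual of $v$ controls its distance to the solution: the Lipschitz constant $1/6$ of the
logarithm allows the factor $6/5$, rounded up to $2$. Zero residual gives uniqueness; small residual
gives the numerical bounds. -/
lemma IsLambertSol.norm_sub_le {k : ℤ} (hk : 1 ≤ k) {v w : ℂ} (h : IsLambertSol k w)
    (hv : 2 * Real.pi ≤ v.im) :
    ‖w - v‖ ≤ 2 * ‖v + Complex.log v - (-1 + (2 * k + 1) * Real.pi * I)‖ := by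
  have h1 := norm_log_sub_log_le hv (h.two_pi_le_im hk)
  have e : w - v = -(v + Complex.log v - (-1 + (2 * k + 1) * Real.pi * I)) +
      (Complex.log v - Complex.log w) := by
    rw [← h.2]; ring
  have h2 : ‖w - v‖ ≤ ‖v + Complex.log v - (-1 + (2 * k + 1) * Real.pi * I)‖ +
      ‖Complex.log v - Complex.log w‖ := by
    conv_lhs => rw [e]
    refine (norm_add_le _ _).trans ?_
    rw [norm_neg]
  rw [norm_sub_rev v w] at h1
  linarith [norm_nonneg (w - v)]

lemma IsLambertSol.unique_of_one_le {k : ℤ} (hk : 1 ≤ k) {v w : ℂ} (h : IsLambertSol k w)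
    (h' : IsLambertSol k v) : w = v := by
  have := h.norm_sub_le hk (h'.two_pi_le_im hk)
  rw [h'.2, sub_self, norm_zero, mul_zero] at this
  exact sub_eq_zero.1 (norm_le_zero_iff.1 this)

lemma IsLambertSol.unique {k : ℤ} (hk : k ≠ -1) (hk0 : k ≠ 0) {v w : ℂ} (h : IsLambertSol k w)
    (h' : IsLambertSol k v) : w = v := by
  rcases lt_or_ge k 1 with h1 | h1
  · exact (starRingEnd ℂ).injective (h.conj.unique_of_one_le (by omega) h'.conj)
  · exact h.unique_of_one_le h1 h'

/-- Banach's fixed point theorem for $w\mapsto-1+(2k+1)\pi i-\mathrm{Log}\,w$ on the half-plane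
$\mathrm{Im}\ge2\pi$. -/
lemma exists_isLambertSol_of_one_le {k : ℤ} (hk : 1 ≤ k) : ∃ w, IsLambertSol k w := by
  have hpi := Real.pi_gt_three
  set S : Set ℂ := {z | 2 * Real.pi ≤ z.im}
  set Φ : ℂ → ℂ := fun w => -1 + (2 * k + 1) * Real.pi * I - Complex.log w with hΦ
  have hS : IsComplete S := (isClosed_le continuous_const Complex.continuous_im).isComplete
  have hmaps : Set.MapsTo Φ S S := by
    intro w _
    have h3 : (1 : ℝ) ≤ k := by exact_mod_cast hk
    have h2 := Complex.arg_le_pi w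
    change 2 * Real.pi ≤ (Φ w).im
    simp only [hΦ]
    simp [Complex.log_im]
    nlinarith
  have hcontr : ContractingWith (1 / 6) (hmaps.restrict Φ S S) := by
    refine ⟨?_, LipschitzWith.of_dist_le_mul fun v w => ?_⟩
    · rw [← NNReal.coe_lt_coe]; norm_num
    · have := norm_log_sub_log_le w.2 v.2
      simp only [Subtype.dist_eq, Set.MapsTo.val_restrict_apply, hΦ]
      rw [dist_eq_norm, dist_eq_norm]
      rw [norm_sub_rev (w : ℂ)] at this
      simpa using this
  obtain ⟨y, hy, hfix, -⟩ := hcontr.exists_fixedPoint' hS hmaps (x := ((2 * Real.pi : ℝ) : ℂ) * I)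
    (show 2 * Real.pi ≤ (((2 * Real.pi : ℝ) : ℂ) * I).im by simp) (edist_ne_top _ _)
  have hy : 2 * Real.pi ≤ y.im := hy
  refine ⟨y, by linarith, ?_⟩
  have : -1 + (2 * k + 1) * Real.pi * I - Complex.log y = y := hfix
  linear_combination -this

lemma exists_isLambertSol {k : ℤ} (hk : k ≠ -1) (hk0 : k ≠ 0) : ∃ w, IsLambertSol k w := by
  rcases lt_or_ge k 1 with h1 | h1
  · obtain ⟨w, hw⟩ := exists_isLambertSol_of_one_le (k := -1 - k) (by omega)
    refine ⟨(starRingEnd ℂ) w, ?_⟩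
    have := hw.conj
    rw [show -1 - (-1 - k) = k by ring] at this
    exact this
  · exact exists_isLambertSol_of_one_le h1

lemma isLambertSol_lambertW {k : ℤ} (hk : k ≠ -1) (hk0 : k ≠ 0) :
    IsLambertSol k (lambertW k (-1 / Complex.exp 1)) := by
  obtain ⟨w, hw⟩ := exists_isLambertSol hk hk0
  have hw' := (mem_lambertRange_and_iff hk hk0 w).2 hw
  have h : ∃ a ∈ lambertRange k, (fun w : ℂ => w * Complex.exp w) a = -1 / Complex.exp 1 :=
    ⟨w, hw'.1, hw'.2⟩
  exact (mem_lambertRange_and_iff hk hk0 _).1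
    ⟨Function.invFunOn_mem h, Function.invFunOn_eq h⟩

lemma mul_exp_neg_sub_one_iff (s : ℂ) :
    (-s - 1) * Complex.exp (-s - 1) = -1 / Complex.exp 1 ↔ Complex.exp s = 1 + s := by
  rw [Complex.exp_sub, Complex.exp_neg]
  have h1 := Complex.exp_ne_zero 1
  have h2 := Complex.exp_ne_zero s
  field_simp
  constructor
  · intro h; linear_combination h
  · intro h; linear_combination h

/-- Put $v=\mathrm{Im}\,w$; the imaginary part of the equation says $\mathrm{Arg}\,w=\pi-v$ with
$0<v<\pi$, so $|w|\sin v=v$ and $|w|\cos v=-\mathrm{Re}\,w$. Then $\sin v<v$ forces $|w|>1$, and the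
real part of the equation gives $|w|\cos v>1$. But $v\cos v<\sin v$ gives $|w|\cos v<1$. -/
lemma not_log_eq_of_im_ne_zero {w : ℂ} (him : w.im ≠ 0) :
    w + Complex.log w ≠ -1 + (2 * (0 : ℤ) + 1) * Real.pi * I := by
  intro h
  have h1 := im_add_arg_of_log h
  have h2 := re_add_log_norm_of_log h
  have hpi := Real.pi_pos
  rw [Int.cast_zero, mul_zero, zero_add, one_mul] at h1
  have hw0 : w ≠ 0 := by rintro rfl; simp at him
  have hn : 0 < ‖w‖ := norm_pos_iff.2 hw0
  have hpos : 0 < w.im := by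
    have h3 := Complex.arg_le_pi w
    have : 0 ≤ w.im := by linarith
    exact lt_of_le_of_ne this (Ne.symm him)
  have harg0 : 0 < w.arg := by
    have h4 : 0 ≤ w.arg := Complex.arg_nonneg_iff.2 hpos.le
    refine lt_of_le_of_ne h4 fun h5 => ?_
    exact him (Complex.arg_eq_zero_iff.1 h5.symm).2
  set v := w.im with hv
  have hvpi : v < Real.pi := by linarith
  have hs : Real.sin v * ‖w‖ = v := by
    rw [show v = Real.pi - w.arg by linarith, Real.sin_pi_sub, Complex.sin_arg, ← hv,
      div_mul_cancel₀ _ hn.ne']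
    linarith
  have hc : Real.cos v * ‖w‖ = -w.re := by
    rw [show v = Real.pi - w.arg by linarith, Real.cos_pi_sub, Complex.cos_arg hw0]
    field_simp
  have hsin : 0 < Real.sin v := Real.sin_pos_of_pos_of_lt_pi hpos hvpi
  have hlt : Real.sin v < v := Real.sin_lt hpos
  have hnorm : 1 < ‖w‖ := by
    by_contra hle
    push Not at hle
    nlinarith
  have hre : w.re < -1 := by linarith [Real.log_pos hnorm]
  have hvc : v * Real.cos v < Real.sin v := by
    rcases lt_or_ge v (Real.pi / 2) with h5 | h5
    · have h6 := Real.lt_tan hpos h5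
      have h7 : 0 < Real.cos v := Real.cos_pos_of_mem_Ioo ⟨by linarith, h5⟩
      rwa [Real.tan_eq_sin_div_cos, lt_div_iff₀ h7] at h6
    · have := Real.cos_nonpos_of_pi_div_two_le_of_le h5 (by linarith)
      nlinarith
  have h8 : Real.cos v * ‖w‖ < 1 := by
    have : Real.sin v * (Real.cos v * ‖w‖) < Real.sin v * 1 := by nlinarith
    exact lt_of_mul_lt_mul_left this hsin.le
  linarith

/-- Every zero $s$ is non-real, so $-s-1$ solves the logarithmic equation for some $n$. The case
$n=0$ is impossible, and $n=-1$ reduces to it by conjugation; uniqueness on the remaining branches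
identifies $s$ with $\xi_n$. -/
theorem zeros_limitW_eq_image_xi : {s : ℂ | limitW s = 0} = xi '' {k : ℤ | k ≠ -1 ∧ k ≠ 0} := by
  ext s
  simp only [Set.mem_ofPred_eq, Set.mem_image]
  constructor
  · intro hs
    have hs2 := (limitW_eq_zero_iff s).1 hs
    have him : (-s - 1).im ≠ 0 := by
      intro h
      have h' : s.im = 0 := by simpa using h
      have : s = (s.re : ℂ) := Complex.ext (by simp) (by simp [h'])
      rw [this] at hs
      exact limitW_ofReal_ne_zero _ hs
    obtain ⟨n, hn⟩ := exists_int_log ((mul_exp_neg_sub_one_iff s).2 hs2.2)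
    have hsol : IsLambertSol n (-s - 1) := ⟨him, hn⟩
    have hn0 : n ≠ 0 := by
      rintro rfl
      exact not_log_eq_of_im_ne_zero him hn
    have hn1 : n ≠ -1 := by
      rintro rfl
      have := hsol.conj
      exact not_log_eq_of_im_ne_zero this.1 this.2
    refine ⟨n, ⟨hn1, hn0⟩, ?_⟩
    rw [xi, (isLambertSol_lambertW hn1 hn0).unique hn1 hn0 hsol]
    ring
  · rintro ⟨k, ⟨hk, hk0⟩, rfl⟩
    have h := isLambertSol_lambertW hk hk0
    set w := lambertW k (-1 / Complex.exp 1) with hw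
    have hx : -xi k - 1 = w := by rw [xi]; ring
    have hw0 : w ≠ 0 := by intro h0; rw [h0] at h; exact h.1 rfl
    refine (limitW_eq_zero_iff _).2 ⟨fun h0 => ?_, ?_⟩
    · rw [h0] at hx
      apply h.1
      rw [← hx]; simp
    · rw [← mul_exp_neg_sub_one_iff, hx]
      exact mul_exp_of_log hw0 h.2

lemma xi_injOn : Set.InjOn xi {k : ℤ | k ≠ -1 ∧ k ≠ 0} := by
  rintro k ⟨hk, hk0⟩ l ⟨hl, hl0⟩ h
  have h1 := im_add_arg_of_log (isLambertSol_lambertW hk hk0).2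
  have h2 := im_add_arg_of_log (isLambertSol_lambertW hl hl0).2
  have e : lambertW k (-1 / Complex.exp 1) = lambertW l (-1 / Complex.exp 1) := by
    simp only [xi] at h
    linear_combination -h
  rw [e, h2] at h1
  have := mul_right_cancel₀ Real.pi_ne_zero h1
  have : (2 * l + 1 : ℤ) = 2 * k + 1 := by exact_mod_cast this
  omega

theorem infinite_zeros_limitW : {s : ℂ | limitW s = 0}.Infinite := by
  rw [zeros_limitW_eq_image_xi]
  refine Set.Infinite.image xi_injOn ?_
  refine (Set.infinite_of_injective_forall_mem (f := fun n : ℕ => (n : ℤ) + 1) ?_ ?_)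
  · intro a b h
    simpa using h
  · intro n
    constructor <;> simp <;> omega

lemma xi_eq_conj {k : ℤ} (hk : k ≠ -1) (hk0 : k ≠ 0) : xi k = (starRingEnd ℂ) (xi (-1 - k)) := by
  have h := (isLambertSol_lambertW (k := -1 - k) (by omega) (by omega)).conj
  rw [show -1 - (-1 - k) = k by ring] at h
  rw [xi, xi, (isLambertSol_lambertW hk hk0).unique hk hk0 h]
  simp

/-! ### Certified decimals for $\xi_1$ and $\xi_2$ -/

/-- Horner form of the Taylor polynomial of degree `9` of `exp`. -/
noncomputable def expHorner (z : ℂ) : ℂ :=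
  1 + z * (1 + z / 2 * (1 + z / 3 * (1 + z / 4 * (1 + z / 5 * (1 + z / 6 * (1 + z / 7 *
    (1 + z / 8 * (1 + z / 9))))))))

lemma norm_exp_sub_expHorner_le {z : ℂ} (hz : ‖z‖ ≤ 1 / 2) :
    ‖Complex.exp z - expHorner z‖ ≤ 1 / 10 ^ 9 := by
  have h := Complex.exp_bound (x := z) (by linarith) (n := 10) (by norm_num)
  have e : ∑ m ∈ Finset.range 10, z ^ m / (m.factorial : ℂ) = expHorner z := by
    simp only [Finset.sum_range_succ, Finset.sum_range_zero, Nat.factorial, expHorner]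
    push_cast
    ring
  rw [e] at h
  refine h.trans ?_
  calc ‖z‖ ^ 10 * (((10 : ℕ).succ : ℝ) * (((10 : ℕ).factorial : ℝ) * ((10 : ℕ) : ℝ))⁻¹)
      ≤ (1 / 2) ^ 10 * (((10 : ℕ).succ : ℝ) * (((10 : ℕ).factorial : ℝ) * ((10 : ℕ) : ℝ))⁻¹) := by
        gcongr
    _ ≤ 1 / 10 ^ 9 := by norm_num [Nat.factorial]

/-- A posteriori bound for a solution on the branch `k`, from the approximation
`w ≈ 2^m i e^ℓ`. -/
lemma IsLambertSol.approx {k : ℤ} (hk : 1 ≤ k) {w : ℂ} (h : IsLambertSol k w) {ℓ : ℂ} (m : ℕ)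
    {p q δ ε : ℝ} (hℓ : ‖ℓ‖ ≤ 1 / 2) (hp : |p - (expHorner ℓ).re| ≤ δ)
    (hq : |q - (expHorner ℓ).im| ≤ δ) (hbig : 2 * Real.pi + ε ≤ 2 ^ m * p)
    (hε : 2 ^ m * (δ + 1 / 10 ^ 9) ≤ ε)
    (hre : |-(2 ^ m * q) + (m * Real.log 2 + ℓ.re) + 1| ≤ ε)
    (him : |2 ^ m * p + ℓ.im + Real.pi / 2 - (2 * k + 1) * Real.pi| ≤ ε) :
    |w.re + 2 ^ m * q| ≤ 9 * ε ∧ |w.im - 2 ^ m * p| ≤ 9 * ε := by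
  have hpi := Real.pi_gt_three
  set E := Complex.exp ℓ with hE
  have hTE := norm_exp_sub_expHorner_le hℓ
  have hEr : |E.re - p| ≤ δ + 1 / 10 ^ 9 := by
    have h1 := (Complex.abs_re_le_norm (E - expHorner ℓ)).trans hTE
    rw [Complex.sub_re] at h1
    rw [abs_le] at *
    constructor <;> linarith [h1.1, h1.2, hp.1, hp.2]
  have hEi : |E.im - q| ≤ δ + 1 / 10 ^ 9 := by
    have h1 := (Complex.abs_im_le_norm (E - expHorner ℓ)).trans hTE
    rw [Complex.sub_im] at h1
    rw [abs_le] at *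
    constructor <;> linarith [h1.1, h1.2, hq.1, hq.2]
  have hscale : ∀ x y : ℝ, |x - y| ≤ δ + 1 / 10 ^ 9 → |2 ^ m * x - 2 ^ m * y| ≤ ε := by
    intro x y hxy
    rw [← mul_sub, abs_mul, abs_of_pos (by positivity : (0:ℝ) < 2 ^ m)]
    exact (mul_le_mul_of_nonneg_left hxy (by positivity)).trans hε
  have hEr' := hscale _ _ hEr
  have hEi' := hscale _ _ hEi
  set L : ℂ := ((m * Real.log 2 : ℝ) : ℂ) + ((Real.pi / 2 : ℝ) : ℂ) * I + ℓ with hL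
  set v : ℂ := Complex.exp L with hv
  have hvE : v = ((2 ^ m : ℝ) : ℂ) * (I * E) := by
    rw [hv, hL, Complex.exp_add, Complex.exp_add, ← Complex.ofReal_exp, Real.exp_nat_mul,
      Real.exp_log two_pos, Complex.ofReal_div]
    have := Complex.exp_pi_div_two_mul_I
    push_cast at this ⊢
    rw [this]; ring
  have hvre : v.re = -(2 ^ m * E.im) := by
    rw [hvE, Complex.re_ofReal_mul]; simp
  have hvim : v.im = 2 ^ m * E.re := by
    rw [hvE, Complex.im_ofReal_mul]; simp
  have hLim : L.im = Real.pi / 2 + ℓ.im := by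
    rw [hL]; simp only [Complex.add_im, Complex.ofReal_im, Complex.im_ofReal_mul, Complex.I_im]; ring
  have hLre : L.re = m * Real.log 2 + ℓ.re := by
    rw [hL]; simp only [Complex.add_re, Complex.ofReal_re, Complex.re_ofReal_mul, Complex.I_re]; ring
  -- Defining $v$ as an exponential makes its logarithm exact, so only $e^\ell$ has to be
  -- approximated.
  have hlog : Complex.log v = L := by
    have h1 := (Complex.abs_im_le_norm ℓ).trans hℓ
    rw [abs_le] at h1
    exact Complex.log_exp (by rw [hLim]; linarith) (by rw [hLim]; linarith)
  have hvbig : 2 * Real.pi ≤ v.im := by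
    rw [hvim]; rw [abs_le] at hEr'; linarith [hEr'.1]
  have hmain := h.norm_sub_le hk hvbig
  -- Each coordinate carries $\varepsilon$ from approximating $e^\ell$ and $\varepsilon$ from the
  -- hypothesis. The a posteriori bound doubles the total to $8\varepsilon$, and passing from $v$ to
  -- the decimals costs one more $\varepsilon$.
  have hres : ‖v + Complex.log v - (-1 + (2 * k + 1) * Real.pi * I)‖ ≤ 4 * ε := by
    refine (Complex.norm_le_abs_re_add_abs_im _).trans ?_
    have e1 : (v + Complex.log v - (-1 + (2 * k + 1) * Real.pi * I)).re =
        -(2 ^ m * E.im) + (m * Real.log 2 + ℓ.re) + 1 := by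
      rw [hlog]; simp [hvre, hLre]
    have e2 : (v + Complex.log v - (-1 + (2 * k + 1) * Real.pi * I)).im =
        2 ^ m * E.re + (Real.pi / 2 + ℓ.im) - (2 * k + 1) * Real.pi := by
      rw [hlog]; simp [hvim, hLim]
    rw [e1, e2]
    have b1 : |-(2 ^ m * E.im) + (m * Real.log 2 + ℓ.re) + 1| ≤ 2 * ε := by
      rw [abs_le] at *
      constructor <;> linarith [hEi'.1, hEi'.2, hre.1, hre.2]
    have b2 : |2 ^ m * E.re + (Real.pi / 2 + ℓ.im) - (2 * k + 1) * Real.pi| ≤ 2 * ε := by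
      rw [abs_le] at *
      constructor <;> linarith [hEr'.1, hEr'.2, him.1, him.2]
    linarith
  have hwv : ‖w - v‖ ≤ 8 * ε := by linarith
  have c1 := (Complex.abs_re_le_norm (w - v)).trans hwv
  have c2 := (Complex.abs_im_le_norm (w - v)).trans hwv
  rw [Complex.sub_re, hvre] at c1
  rw [Complex.sub_im, hvim] at c2
  rw [abs_le, abs_le]
  rw [abs_le] at hEr' hEi' c1 c2
  refine ⟨⟨?_, ?_⟩, ⟨?_, ?_⟩⟩ <;>
    linarith [hEr'.1, hEr'.2, hEi'.1, hEi'.2, c1.1, c1.2, c2.1, c2.2]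


lemma norm_mk_le_half {a b : ℝ} (h : a ^ 2 + b ^ 2 ≤ 1 / 4) : ‖(⟨a, b⟩ : ℂ)‖ ≤ 1 / 2 := by
  rw [← sq_le_sq₀ (norm_nonneg _) (by norm_num), ← Complex.normSq_eq_norm_sq, Complex.normSq_mk]
  linarith

lemma xi_one_approx : |(xi 1).re - 2.08884| < 0.00001 ∧ |(xi 1).im + 7.46148| < 0.00001 := by
  -- Here $p+iq\approx W(1,-1/e)/(8i)$ and $\ell$ is approximately its logarithm. The tabulated
  -- $7.46148$ is already about $9.3\cdot10^{-6}$ away from the modulus of the imaginary part, so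
  -- $9\varepsilon=4.5\cdot10^{-7}$ has to fit into the small remaining margin.
  have h := (isLambertSol_lambertW (k := 1) (by norm_num) (by norm_num)).approx le_rfl 3
    (ℓ := ⟨0.0094014739, 0.3924923483⟩) (p := 0.9326861606) (q := 0.3861053769)
    (δ := 2 / 10 ^ 9) (ε := 5 / 10 ^ 8) (norm_mk_le_half (by norm_num))
    (by norm_num [expHorner, abs_le]) (by norm_num [expHorner, abs_le])
    (by have := Real.pi_lt_d2; norm_num; linarith) (by norm_num)
    (by
      have h1 := Real.log_two_gt_d9
      have h2 := Real.log_two_lt_d9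
      norm_num [abs_le] at h1 h2 ⊢
      constructor <;> linarith)
    (by
      have h1 := Real.pi_gt_d20
      have h2 := Real.pi_lt_d20
      norm_num [abs_le] at h1 h2 ⊢
      constructor <;> linarith)
  obtain ⟨h1, h2⟩ := h
  rw [xi]
  simp only [Complex.sub_re, Complex.sub_im, Complex.neg_re, Complex.neg_im, Complex.one_re,
    Complex.one_im]
  rw [abs_le] at h1 h2
  rw [abs_lt, abs_lt]
  norm_num at h1 h2 ⊢
  refine ⟨⟨?_, ?_⟩, ⟨?_, ?_⟩⟩ <;> linarith [h1.1, h1.2, h2.1, h2.2]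

lemma xi_two_approx : |(xi 2).re - 2.66406| < 0.00001 ∧ |(xi 2).im + 13.87905| < 0.00001 := by
  have h := (isLambertSol_lambertW (k := 2) (by norm_num) (by norm_num)).approx (by norm_num) 4
    (ℓ := ⟨-0.1085205798, 0.2581109384⟩) (p := 0.8674410001) (q := 0.2290042588)
    (δ := 2 / 10 ^ 9) (ε := 5 / 10 ^ 8) (norm_mk_le_half (by norm_num))
    (by norm_num [expHorner, abs_le]) (by norm_num [expHorner, abs_le])
    (by have := Real.pi_lt_d2; norm_num; linarith) (by norm_num)
    (by
      have h1 := Real.log_two_gt_d9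
      have h2 := Real.log_two_lt_d9
      norm_num [abs_le] at h1 h2 ⊢
      constructor <;> linarith)
    (by
      have h1 := Real.pi_gt_d20
      have h2 := Real.pi_lt_d20
      norm_num [abs_le] at h1 h2 ⊢
      constructor <;> linarith)
  obtain ⟨h1, h2⟩ := h
  rw [xi]
  simp only [Complex.sub_re, Complex.sub_im, Complex.neg_re, Complex.neg_im, Complex.one_re,
    Complex.one_im]
  rw [abs_le] at h1 h2
  rw [abs_lt, abs_lt]
  norm_num at h1 h2 ⊢
  refine ⟨⟨?_, ?_⟩, ⟨?_, ?_⟩⟩ <;> linarith [h1.1, h1.2, h2.1, h2.2]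

/-! ### Zeros under locally uniform convergence -/

section Hurwitz

variable {ι : Type*} {l : Filter ι} {F : ι → ℂ → ℂ} {f : ℂ → ℂ}

lemma tendstoLocallyUniformlyOn_of_isCompact
    (h : ∀ K : Set ℂ, IsCompact K → TendstoUniformlyOn F f l K) :
    TendstoLocallyUniformlyOn F f l Set.univ :=
  (tendstoLocallyUniformlyOn_iff_forall_isCompact isOpen_univ).2 fun K _ hK => h K hK

lemma differentiable_of_tendstoUniformlyOn [l.NeBot] (hF : ∀ᶠ i in l, Differentiable ℂ (F i))
    (h : ∀ K : Set ℂ, IsCompact K → TendstoUniformlyOn F f l K) : Differentiable ℂ f :=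
  differentiableOn_univ.1 ((tendstoLocallyUniformlyOn_of_isCompact h).differentiableOn
    (hF.mono fun _ hi => hi.differentiableOn) isOpen_univ)

lemma eventually_ne_zero_of_exists_ne_zero (hf : Differentiable ℂ f) {a : ℂ} (ha : f a ≠ 0)
    (z₀ : ℂ) : ∀ᶠ z in 𝓝[≠] z₀, f z ≠ 0 := by
  have han : AnalyticOnNhd ℂ f Set.univ := fun z _ => hf.analyticAt z
  refine (hf.analyticAt z₀).eventually_eq_zero_or_eventually_ne_zero.resolve_left fun h => ?_
  exact ha (han.eqOn_zero_of_preconnected_of_eventuallyEq_zero isPreconnected_univ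
    (Set.mem_univ z₀) h (Set.mem_univ a))

/-- A zero of the limit of holomorphic functions is a limit of zeros. -/
lemma eventually_exists_zero (hF : ∀ᶠ i in l, Differentiable ℂ (F i)) (hf : Differentiable ℂ f)
    (h : ∀ K : Set ℂ, IsCompact K → TendstoUniformlyOn F f l K) {z₀ : ℂ} (hz : f z₀ = 0)
    (hne : ∀ᶠ z in 𝓝[≠] z₀, f z ≠ 0) {ε : ℝ} (hε : 0 < ε) :
    ∀ᶠ i in l, ∃ z, dist z z₀ < ε ∧ F i z = 0 := by
  obtain ⟨δ, hδ, hball⟩ := Metric.mem_nhdsWithin_iff.1 hne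
  set ρ : ℝ := min δ ε / 2 with hρ
  have hρ0 : 0 < ρ := by positivity
  have hρδ : ρ < δ := by
    have := min_le_left δ ε
    have : 0 < min δ ε := by positivity
    linarith
  have hρε : ρ < ε := by
    have := min_le_right δ ε
    have : 0 < min δ ε := by positivity
    linarith
  have hsph : ∀ z ∈ Metric.sphere z₀ ρ, f z ≠ 0 := by
    intro z hz
    have hz' : dist z z₀ = ρ := hz
    refine hball ⟨by rw [Metric.mem_ball, hz']; exact hρδ, ?_⟩
    intro he
    have he : z = z₀ := he
    rw [he, dist_self] at hz'
    linarith
  obtain ⟨x, hx, hmin⟩ := (isCompact_sphere z₀ ρ).exists_isMinOn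
    (NormedSpace.sphere_nonempty.2 hρ0.le) (hf.continuous.norm.continuousOn)
  set m : ℝ := ‖f x‖ with hm
  have hm0 : 0 < m := norm_pos_iff.2 (hsph x hx)
  have hu := Metric.tendstoUniformlyOn_iff.1 (h _ (isCompact_closedBall z₀ ρ)) (m / 4)
    (by positivity)
  filter_upwards [hF, hu] with i hi hui
  have hui' : ∀ z ∈ Metric.closedBall z₀ ρ, ‖f z - F i z‖ < m / 4 := fun z hz => by
    rw [← dist_eq_norm]; exact hui z hz
  have h0 : ‖F i z₀‖ < m / 4 := by
    have := hui' z₀ (Metric.mem_closedBall_self hρ0.le)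
    rwa [hz, zero_sub, norm_neg] at this
  have hlow : ∀ z ∈ Metric.sphere z₀ ρ, m / 2 ≤ ‖F i z - F i z₀‖ := by
    intro z hz
    have h1 : m ≤ ‖f z‖ := hmin hz
    have h2 := hui' z (Metric.sphere_subset_closedBall hz)
    have h3 : ‖f z‖ ≤ ‖f z - F i z‖ + ‖F i z - F i z₀‖ + ‖F i z₀‖ := by
      have := norm_add₃_le (a := f z - F i z) (b := F i z - F i z₀) (c := F i z₀)
      simpa using this
    linarith
  have hfreq : ∃ᶠ z in 𝓝 z₀, F i z ≠ F i z₀ := by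
    have hx0 : F i x - F i z₀ ≠ 0 := by
      rw [← norm_pos_iff]; linarith [hlow x hx]
    have := eventually_ne_zero_of_exists_ne_zero (f := fun z => F i z - F i z₀)
      (hi.sub_const _) hx0 z₀
    exact (this.frequently.filter_mono nhdsWithin_le_nhds).mono fun z hz => sub_ne_zero.1 hz
  -- Quantitative open mapping: on the sphere the values stay $m/2$ away from $F_i(z_0)$, so the
  -- image contains the ball of radius $m/4$ about $F_i(z_0)$, and this ball contains $0$.
  obtain ⟨z, hz1, hz2⟩ := hi.diffContOnCl.ball_subset_image_closedBall hρ0 hlow hfreq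
    (show (0 : ℂ) ∈ _ by rw [mem_ball_iff_norm, zero_sub, norm_neg]; linarith)
  exact ⟨z, (Metric.mem_closedBall.1 hz1).trans_lt hρε, hz2⟩

/-- Near a simple zero of the limit, the approximating functions have a unique zero, which is
simple and converges to the given one. -/
lemma exists_tendsto_simple_zero [l.NeBot] (hF : ∀ᶠ i in l, Differentiable ℂ (F i))
    (h : ∀ K : Set ℂ, IsCompact K → TendstoUniformlyOn F f l K) {z₀ : ℂ} (hz : f z₀ = 0)
    (hd : deriv f z₀ ≠ 0) :
    ∃ g : ι → ℂ, ∃ ε > 0, Tendsto g l (𝓝 z₀) ∧ ∀ᶠ i in l, F i (g i) = 0 ∧ deriv (F i) (g i) ≠ 0 ∧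
      ∀ z ∈ Metric.ball z₀ ε, F i z = 0 → z = g i := by
  have hf : Differentiable ℂ f := differentiable_of_tendstoUniformlyOn hF h
  set A := deriv f z₀ with hA
  have hA0 : 0 < ‖A‖ := norm_pos_iff.2 hd
  have hdc : Continuous (deriv f) := (hf.contDiff (n := 1)).continuous_deriv_one
  obtain ⟨ε, hε, hball⟩ := Metric.continuousAt_iff.1 (hdc.continuousAt (x := z₀)) (‖A‖ / 4)
    (by positivity)
  have hder := (tendstoLocallyUniformlyOn_of_isCompact h).deriv
    (hF.mono fun _ hi => hi.differentiableOn) isOpen_univ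
  have hu := Metric.tendstoUniformlyOn_iff.1
    ((tendstoLocallyUniformlyOn_iff_forall_isCompact isOpen_univ).1 hder _ (Set.subset_univ _)
      (isCompact_closedBall z₀ ε)) (‖A‖ / 4) (by positivity)
  have hclose : ∀ᶠ i in l, ∀ z ∈ Metric.ball z₀ ε, ‖deriv (F i) z - A‖ ≤ ‖A‖ / 2 := by
    filter_upwards [hu] with i hi z hz
    have h1 : ‖deriv f z - A‖ < ‖A‖ / 4 := by rw [← dist_eq_norm]; exact hball hz
    have h2 : ‖deriv f z - deriv (F i) z‖ < ‖A‖ / 4 := by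
      rw [← dist_eq_norm]; exact hi z (Metric.ball_subset_closedBall hz)
    have h3 : ‖deriv (F i) z - A‖ ≤ ‖deriv f z - deriv (F i) z‖ + ‖deriv f z - A‖ := by
      rw [norm_sub_rev (deriv f z) (deriv (F i) z)]
      simpa using norm_add_le (deriv (F i) z - deriv f z) (deriv f z - A)
    linarith
  -- On the ball $F_i(z)-Az$ has Lipschitz constant $|A|/2$, too small to cancel the linear part
  -- $Az$.
  have hinj : ∀ᶠ i in l, Set.InjOn (F i) (Metric.ball z₀ ε) := by
    filter_upwards [hF, hclose] with i hi hci x hx y hy hxy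
    have := (convex_ball z₀ ε).norm_image_sub_le_of_norm_deriv_le (𝕜 := ℂ)
      (f := fun z => F i z - A * z) (C := ‖A‖ / 2) (fun z _ => (hi z).sub (by fun_prop))
      (fun z hz => by
        have e : deriv (fun z => F i z - A * z) z = deriv (F i) z - A := by
          have : HasDerivAt (fun z => F i z - A * z) (deriv (F i) z - A * 1) z :=
            (hi z).hasDerivAt.sub ((hasDerivAt_id z).const_mul A)
          rw [this.deriv, mul_one]
        rw [e]; exact hci z hz) hx hy
    rw [hxy, show F i y - A * y - (F i y - A * x) = -(A * (y - x)) by ring, norm_neg,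
      norm_mul] at this
    have h0 : ‖y - x‖ ≤ 0 := by
      by_contra hpos
      push Not at hpos
      nlinarith
    exact (sub_eq_zero.1 (norm_le_zero_iff.1 h0)).symm
  have hne : ∀ᶠ z in 𝓝[≠] z₀, f z ≠ 0 := by
    have := (hf z₀).hasDerivAt.eventually_ne (c := 0) hd
    exact this
  classical
  set g : ι → ℂ := fun i => if hi : ∃ z, dist z z₀ < ε ∧ F i z = 0 then hi.choose else z₀ with hg
  have hgspec : ∀ᶠ i in l, dist (g i) z₀ < ε ∧ F i (g i) = 0 := by
    filter_upwards [eventually_exists_zero hF hf h hz hne hε] with i hi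
    simp only [hg, dif_pos hi]
    exact hi.choose_spec
  have huniq : ∀ᶠ i in l, ∀ z ∈ Metric.ball z₀ ε, F i z = 0 → z = g i := by
    filter_upwards [hgspec, hinj] with i hi hin z hz hz0
    exact hin hz hi.1 (hz0.trans hi.2.symm)
  refine ⟨g, ε, hε, ?_, ?_⟩
  · rw [Metric.tendsto_nhds]
    intro η hη
    filter_upwards [eventually_exists_zero hF hf h hz hne (lt_min hε hη), huniq] with i hi hui
    obtain ⟨z, hz1, hz2⟩ := hi
    rw [← hui z (hz1.trans_le (min_le_left _ _)) hz2]
    exact hz1.trans_le (min_le_right _ _)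
  · filter_upwards [hgspec, huniq, hclose] with i h1 h2 h3
    refine ⟨h1.2, fun h0 => ?_, h2⟩
    have := h3 _ h1.1
    rw [h0, zero_sub, norm_neg] at this
    linarith

end Hurwitz

/-! ### Non-real zeros for small $\alpha$ -/

lemma phi_zero_left (c r : ℝ) (s : ℂ) : phi c r 0 s = 0 := by
  simp [phi, fAlpha, rectIntegral]

lemma differentiable_limitW : Differentiable ℂ limitW :=
  differentiable_of_tendstoUniformlyOn (l := 𝓝[≠] (0 : ℂ))
    (F := fun α s => phi 2 1 α s / (α * Complex.exp α))
    (Eventually.of_forall fun α => (differentiable_phi_right one_lt_two one_pos α).div_const _)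
    fun _ hK => tendstoUniformlyOn_phi_zero one_lt_two one_pos hK

theorem exists_nonreal_zeros {c r : ℝ} (hc : 1 < c) (hr : 0 < r) (n : ℕ) :
    ∃ δ : ℝ, 0 < δ ∧ ∀ α : ℂ, ‖α‖ < δ →
      ∃ S : Finset ℂ, S.card = n ∧ ∀ s ∈ S, phi c r α s = 0 ∧ s.im ≠ 0 := by
  classical
  obtain ⟨Z, hZ, hcard⟩ := infinite_zeros_limitW.exists_subset_card_eq n
  have hZ0 : ∀ z ∈ Z, limitW z = 0 := fun z hz => hZ hz
  have hZim : ∀ z ∈ Z, z.im ≠ 0 := by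
    intro z hz h0
    have : z = (z.re : ℂ) := Complex.ext (by simp) (by simp [h0])
    have hz0 := hZ0 z hz
    rw [this] at hz0
    exact limitW_ofReal_ne_zero _ hz0
  -- The radius must keep the perturbed zeros off the real axis and distinct from one another.
  have hev : ∀ᶠ ε : ℝ in 𝓝[>] 0, ∀ z ∈ Z, ε < |z.im| ∧ ∀ z' ∈ Z, z ≠ z' → 2 * ε < dist z z' := by
    refine (Finset.eventually_all Z).2 fun z hz => ?_
    refine Eventually.and ?_ ((Finset.eventually_all Z).2 fun z' _ => ?_)
    · exact eventually_nhdsWithin_of_eventually_nhds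
        (eventually_lt_nhds (abs_pos.2 (hZim z hz)))
    · by_cases hzz : z = z'
      · exact Eventually.of_forall fun ε h => absurd hzz h
      · have hd : 0 < dist z z' / 2 := by
          have := dist_pos.2 hzz
          positivity
        filter_upwards [eventually_nhdsWithin_of_eventually_nhds (eventually_lt_nhds hd)] with ε hε _
        linarith
  obtain ⟨ε, hεZ, hε⟩ := (hev.and self_mem_nhdsWithin).exists
  have hε : 0 < ε := hε
  have h1 : ∀ᶠ α : ℂ in 𝓝[≠] 0, ∀ z ∈ Z, ∃ s, dist s z < ε ∧
      phi c r α s / (α * Complex.exp α) = 0 := by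
    refine (Finset.eventually_all Z).2 fun z hz => ?_
    exact eventually_exists_zero
      (Eventually.of_forall fun α => (differentiable_phi_right hc hr α).div_const _)
      differentiable_limitW (fun _ hK => tendstoUniformlyOn_phi_zero hc hr hK) (hZ0 z hz)
      (eventually_ne_zero_of_exists_ne_zero differentiable_limitW
        (limitW_ofReal_ne_zero 0) z) hε
  obtain ⟨δ, hδ, hball⟩ := Metric.mem_nhdsWithin_iff.1 h1
  refine ⟨δ, hδ, fun α hα => ?_⟩
  rcases eq_or_ne α 0 with rfl | hα0
  -- At $\alpha=0$ the function vanishes identically, so any non-real points will do.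
  · exact ⟨Z, hcard, fun s hs => ⟨phi_zero_left c r s, hZim s hs⟩⟩
  have h2 : ∀ z ∈ Z, ∃ s, dist s z < ε ∧ phi c r α s / (α * Complex.exp α) = 0 :=
    hball ⟨by simpa using hα, hα0⟩
  choose! g hg1 hg2 using h2
  refine ⟨Z.image g, ?_, ?_⟩
  · rw [Finset.card_image_of_injOn, hcard]
    intro x hx y hy hxy
    by_contra hne
    have h3 := (hεZ x hx).2 y hy hne
    have h4 := hg1 x hx
    have h5 := hg1 y hy
    rw [← hxy] at h5
    have := dist_triangle_left x y (g x)
    linarith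
  · intro s hs
    obtain ⟨z, hz, rfl⟩ := Finset.mem_image.1 hs
    constructor
    · have := hg2 z hz
      rw [div_eq_zero_iff] at this
      exact this.resolve_right (mul_ne_zero hα0 (Complex.exp_ne_zero _))
    · intro h0
      have h3 := hg1 z hz
      have h4 := (hεZ z hz).1
      have h5 := Complex.abs_im_le_norm (g z - z)
      rw [Complex.sub_im, h0, zero_sub, abs_neg, ← dist_eq_norm] at h5
      linarith

/-! ### The Bessel limit: differential equation, simple zeros, oscillation -/

/-- Termwise differentiation of an everywhere convergent power series. -/
lemma hasDerivAt_of_hasSum_pow {b : ℕ → ℂ} {f g : ℂ → ℂ}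
    (hf : ∀ s, HasSum (fun n => b n * s ^ n) (f s))
    (hg : ∀ s, HasSum (fun n : ℕ => ((n : ℂ) + 1) * b (n + 1) * s ^ n) (g s)) (s : ℂ) :
    HasDerivAt f (g s) s := by
  set R : ℝ := ‖s‖ + 1 with hR
  have hR1 : 1 ≤ R := by rw [hR]; linarith [norm_nonneg s]
  -- Convergence at $2R$ absorbs the factor $n\le2^n$ produced by differentiation.
  have hu : Summable fun n : ℕ => ‖b n‖ * (2 * R) ^ n := by
    have := (hf ((2 * R : ℝ) : ℂ)).summable.norm
    refine this.congr fun n => ?_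
    rw [norm_mul, norm_pow, Complex.norm_real, Real.norm_of_nonneg (by positivity)]
  have hd := hasDerivAt_tsum_of_isPreconnected (𝕜 := ℂ) (g := fun n z => b n * z ^ n)
    (g' := fun n z => b n * (n * z ^ (n - 1))) (t := Metric.ball 0 R) hu Metric.isOpen_ball
    (convex_ball (0 : ℂ) R).isPreconnected
    (fun n z _ => (hasDerivAt_pow n z).const_mul (b n)) (by
      intro n z hz
      have hz' : ‖z‖ ≤ R := (mem_ball_zero_iff.1 hz).le
      rw [norm_mul, norm_mul, norm_pow, Complex.norm_natCast]
      have h1 : (n : ℝ) ≤ 2 ^ n := by exact_mod_cast n.lt_two_pow_self.le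
      have h2 : ‖z‖ ^ (n - 1) ≤ R ^ n :=
        (pow_le_pow_left₀ (norm_nonneg _) hz' _).trans (pow_le_pow_right₀ hR1 (Nat.sub_le _ _))
      rw [mul_pow]
      gcongr)
    (y₀ := 0) (by simp; linarith) (hf 0).summable (y := s)
    (by rw [mem_ball_zero_iff]; linarith)
  have e1 : (fun z => ∑' n, b n * z ^ n) = f := funext fun z => (hf z).tsum_eq
  rw [e1] at hd
  have hs : Summable fun n : ℕ => b n * (n * s ^ (n - 1)) := by
    refine (summable_nat_add_iff 1).1 ((hg s).summable.congr fun n => ?_)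
    rw [Nat.add_sub_cancel]; push_cast; ring
  have e2 : ∑' n : ℕ, b n * (n * s ^ (n - 1)) = g s := by
    rw [hs.tsum_eq_zero_add, ← (hg s).tsum_eq]
    simp only [Nat.cast_zero, zero_mul, mul_zero, zero_add]
    refine tsum_congr fun n => ?_
    rw [Nat.add_sub_cancel]; push_cast; ring
  rwa [e2] at hd

lemma differentiable_besselLimit : Differentiable ℂ besselLimit :=
  differentiable_of_tendstoUniformlyOn (l := Bornology.cobounded ℂ)
    (F := fun α s => phi 2 1 α (s / α) / (α * Complex.exp α))
    (Eventually.of_forall fun α => ((differentiable_phi_right one_lt_two one_pos α).comp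
      (differentiable_id.div_const α)).div_const _)
    fun _ hK => tendstoUniformlyOn_phi_cobounded one_lt_two one_pos hK

lemma besselLimit_zero : besselLimit 0 = 1 / 2 := by simp [besselLimit]

/-- The coefficients of `besselLimit`. -/
noncomputable def besselCoeff (n : ℕ) : ℂ :=
  1 / 2 * (-1 / 2) ^ n / ((n.factorial : ℂ) * ((n + 1).factorial : ℂ))

lemma hasSum_besselCoeff (s : ℂ) : HasSum (fun n => besselCoeff n * s ^ n) (besselLimit s) := by
  refine (hasSum_besselLimit s).congr_fun fun n => ?_
  rw [besselCoeff, div_pow, div_pow]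
  ring

lemma besselCoeff_succ (n : ℕ) :
    ((n : ℂ) + 1) * (((n : ℂ) + 2) * besselCoeff (n + 1)) = -1 / 2 * besselCoeff n := by
  have f0 : (n.factorial : ℂ) ≠ 0 := by exact_mod_cast n.factorial_ne_zero
  have f1 : ((n : ℂ) + 1) ≠ 0 := by exact_mod_cast n.succ_ne_zero
  have f2 : ((n : ℂ) + 2) ≠ 0 := by exact_mod_cast (n + 1).succ_ne_zero
  rw [besselCoeff, besselCoeff, Nat.factorial_succ (n + 1), Nat.factorial_succ n, pow_succ]
  push_cast
  rw [show ((n : ℂ) + 1 + 1) = n + 2 by ring]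
  field_simp

lemma summable_deriv_besselCoeff (s : ℂ) :
    Summable fun n : ℕ => ((n : ℂ) + 1) * besselCoeff (n + 1) * s ^ n := by
  refine Summable.of_norm_bounded (hasSum_besselCoeff s).summable.norm fun n => ?_
  rw [norm_mul, norm_mul (besselCoeff n)]
  refine mul_le_mul_of_nonneg_right ?_ (norm_nonneg _)
  have h := congrArg (fun z : ℂ => ‖z‖) (besselCoeff_succ n)
  have h2 : ‖(n : ℂ) + 2‖ = n + 2 := by
    rw [show (n : ℂ) + 2 = ((n + 2 : ℕ) : ℂ) by push_cast; ring, Complex.norm_natCast]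
    push_cast; ring
  rw [← mul_assoc, mul_comm ((n : ℂ) + 1), mul_assoc, norm_mul, norm_mul (-1 / 2 : ℂ), h2] at h
  have h3 : ‖(-1 / 2 : ℂ)‖ = 1 / 2 := by norm_num
  rw [h3] at h
  have h4 : 0 ≤ ‖((n : ℂ) + 1) * besselCoeff (n + 1)‖ := norm_nonneg _
  have h5 : (0 : ℝ) ≤ n := Nat.cast_nonneg n
  nlinarith [norm_nonneg (besselCoeff n)]

lemma hasSum_deriv_besselLimit (s : ℂ) :
    HasSum (fun n : ℕ => ((n : ℂ) + 1) * besselCoeff (n + 1) * s ^ n) (deriv besselLimit s) := by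
  have h := hasDerivAt_of_hasSum_pow hasSum_besselCoeff
    (fun s => (summable_deriv_besselCoeff s).hasSum) s
  rw [h.deriv]
  exact (summable_deriv_besselCoeff s).hasSum

/-- The derivative of `s * besselLimit s`. -/
noncomputable def besselAux (s : ℂ) : ℂ := besselLimit s + s * deriv besselLimit s

lemma hasSum_besselAux (s : ℂ) :
    HasSum (fun n : ℕ => ((n : ℂ) + 1) * besselCoeff n * s ^ n) (besselAux s) := by
  have h1 : HasSum (fun n : ℕ => (n : ℂ) * besselCoeff n * s ^ n) (s * deriv besselLimit s) := by
    rw [← hasSum_nat_add_iff' 1]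
    simp only [Finset.sum_range_one, Nat.cast_zero, zero_mul, sub_zero]
    refine ((hasSum_deriv_besselLimit s).mul_left s).congr_fun fun n => ?_
    push_cast; ring
  refine ((hasSum_besselCoeff s).add h1).congr_fun fun n => ?_
  ring

/-- The coefficient recurrence $(n+1)(n+2)b_{n+1}=-b_n/2$ is the equation $(s\beta)''=-\beta/2$ read
off termwise. -/
lemma hasDerivAt_besselAux (s : ℂ) : HasDerivAt besselAux (-1 / 2 * besselLimit s) s := by
  refine hasDerivAt_of_hasSum_pow (g := fun s => -1 / 2 * besselLimit s) hasSum_besselAux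
    (fun s => ?_) s
  refine ((hasSum_besselCoeff s).mul_left (-1 / 2)).congr_fun fun n => ?_
  have := besselCoeff_succ n
  push_cast
  linear_combination s ^ n * this

lemma hasDerivAt_mul_besselLimit (s : ℂ) :
    HasDerivAt (fun s => s * besselLimit s) (besselAux s) s := by
  have := (hasDerivAt_id s).mul (differentiable_besselLimit s).hasDerivAt
  simpa [besselAux] using! this

lemma besselLimit_ofReal_im (x : ℝ) : (besselLimit (x : ℂ)).im = 0 := by
  have h := Complex.hasSum_im (hasSum_besselLimit x)
  refine h.unique ?_
  convert hasSum_zero using 2 with n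
  have : (1 / 2 * ((-1) ^ n * ((x : ℂ) / 2) ^ n / ((n.factorial : ℂ) * ((n + 1).factorial : ℂ)))) =
    ((1 / 2 * ((-1) ^ n * (x / 2) ^ n / ((n.factorial : ℝ) * ((n + 1).factorial : ℝ))) : ℝ) : ℂ) := by
    push_cast; ring
  rw [this, Complex.ofReal_im]

lemma besselLimit_ofReal_eq_zero_iff (x : ℝ) :
    besselLimit (x : ℂ) = 0 ↔ (besselLimit (x : ℂ)).re = 0 := by
  rw [Complex.ext_iff, besselLimit_ofReal_im]; simp

lemma hasDerivAt_real_mul_besselLimit (x : ℝ) :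
    HasDerivAt (fun x : ℝ => x * (besselLimit (x : ℂ)).re) (besselAux x).re x := by
  have := (hasDerivAt_mul_besselLimit x).real_of_complex
  simpa using this

lemma hasDerivAt_real_besselAux (x : ℝ) :
    HasDerivAt (fun x : ℝ => (besselAux (x : ℂ)).re) (-(besselLimit (x : ℂ)).re / 2) x := by
  have := (hasDerivAt_besselAux x).real_of_complex
  convert this using 1
  rw [show (-1 / 2 : ℂ) = ((-1 / 2 : ℝ) : ℂ) by push_cast; rfl, Complex.re_ofReal_mul]
  ring

/-- With $y=x\beta$ and $J=y'$, the form $Q=xJ^2+y^2/2$ has derivative $J^2\ge0$. If $y$ and $J$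
both vanished at $x_0$, then $0\le Q\le Q(x_0)=0$ on $(0,x_0]$, so $\beta$ would vanish there,
against $\beta(0)=1/2$. -/
lemma besselAux_re_ne_zero {x₀ : ℝ} (hx : 0 < x₀) (h0 : (besselLimit (x₀ : ℂ)).re = 0) :
    (besselAux (x₀ : ℂ)).re ≠ 0 := by
  intro hJ
  set β : ℝ → ℝ := fun x => (besselLimit (x : ℂ)).re with hβ
  set J : ℝ → ℝ := fun x => (besselAux (x : ℂ)).re with hJdef
  set Q : ℝ → ℝ := fun x => x * J x ^ 2 + (x * β x) ^ 2 / 2 with hQ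
  have hQd : ∀ x, HasDerivAt Q (J x ^ 2) x := by
    intro x
    have h1 := hasDerivAt_real_mul_besselLimit x
    have h2 := hasDerivAt_real_besselAux x
    have h3 := ((hasDerivAt_id x).mul (h2.pow 2)).add ((h1.pow 2).div_const 2)
    refine h3.congr_deriv ?_
    simp only [hJdef]
    push_cast
    simp
    ring
  have hmono : Monotone Q := monotone_of_hasDerivAt_nonneg hQd fun x => sq_nonneg _
  have hzero : ∀ x ∈ Set.Ioc 0 x₀, β x = 0 := by
    intro x hx'
    have h1 : Q x ≤ Q x₀ := hmono hx'.2
    have h2 : Q x₀ = 0 := by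
      have e1 : J x₀ = 0 := hJ
      have e2 : β x₀ = 0 := h0
      simp [hQ, e1, e2]
    have h3 : 0 ≤ x * J x ^ 2 := mul_nonneg hx'.1.le (sq_nonneg _)
    have h4 : (x * β x) ^ 2 ≤ 0 := by
      have : Q x = x * J x ^ 2 + (x * β x) ^ 2 / 2 := rfl
      linarith
    have h5 : x * β x = 0 := by
      have := le_antisymm h4 (sq_nonneg _)
      exact pow_eq_zero_iff two_ne_zero |>.1 this
    exact (mul_eq_zero.1 h5).resolve_left hx'.1.ne'
  have hβc : Continuous β := by
    have := differentiable_besselLimit.continuous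
    fun_prop
  have hlim : Tendsto β (𝓝[>] 0) (𝓝 (β 0)) := (hβc.tendsto 0).mono_left nhdsWithin_le_nhds
  have hlim0 : Tendsto β (𝓝[>] 0) (𝓝 0) := by
    refine tendsto_const_nhds.congr' ?_
    filter_upwards [Ioc_mem_nhdsGT hx] with x hx using (hzero x hx).symm
  have h6 := tendsto_nhds_unique hlim hlim0
  simp [hβ, besselLimit_zero] at h6

lemma deriv_besselLimit_ne_zero {x : ℝ} (hx : 0 < x) (h0 : besselLimit (x : ℂ) = 0) :
    deriv besselLimit (x : ℂ) ≠ 0 := by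
  intro hd
  refine besselAux_re_ne_zero hx ((besselLimit_ofReal_eq_zero_iff x).1 h0) ?_
  rw [besselAux, hd, h0]; simp

/-- Sturm comparison with `sin (π (x - a) / a)` on `[a, 2a]`. -/
lemma not_forall_pos_of_ode {y J : ℝ → ℝ} {a : ℝ} (ha : 4 * Real.pi ^ 2 ≤ a)
    (hy : ∀ x ∈ Set.Icc a (2 * a), HasDerivAt y (J x) x)
    (hJ : ∀ x ∈ Set.Icc a (2 * a), HasDerivAt J (-(y x / (2 * x))) x) :
    ¬ ∀ x ∈ Set.Icc a (2 * a), 0 < y x := by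
  intro hpos
  have hpi := Real.pi_pos
  have ha0 : 0 < a := lt_of_lt_of_le (by positivity) ha
  set ω : ℝ := Real.pi / a with hω
  have hω0 : 0 < ω := by positivity
  -- The Wronskian with the sine, whose half period is exactly $[a,2a]$. If $y>0$ it is increasing,
  -- yet it equals $\omega y(a)>0$ at the left end and $-\omega y(2a)<0$ at the right end.
  set W : ℝ → ℝ := fun x => y x * (ω * Real.cos (ω * (x - a))) - J x * Real.sin (ω * (x - a))
  have hWd : ∀ x ∈ Set.Icc a (2 * a), HasDerivAt W
      (y x * Real.sin (ω * (x - a)) * (1 / (2 * x) - ω ^ 2)) x := by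
    intro x hx
    have hlin : HasDerivAt (fun x => ω * (x - a)) ω x := by
      simpa using ((hasDerivAt_id x).sub_const a).const_mul ω
    have h1 := (hy x hx).mul (hlin.cos.const_mul ω)
    have h2 := (hJ x hx).mul hlin.sin
    refine (h1.sub h2).congr_deriv ?_
    ring
  have hmono : MonotoneOn W (Set.Icc a (2 * a)) := by
    refine monotoneOn_of_hasDerivWithinAt_nonneg (convex_Icc _ _)
      (f' := fun x => y x * Real.sin (ω * (x - a)) * (1 / (2 * x) - ω ^ 2))
      (fun x hx => (hWd x hx).continuousAt.continuousWithinAt)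
      (fun x hx => (hWd x (interior_subset hx)).hasDerivWithinAt) ?_
    intro x hx
    have hx := interior_subset hx
    have hx0 : 0 < x := ha0.trans_le hx.1
    refine mul_nonneg (mul_nonneg (hpos x hx).le (Real.sin_nonneg_of_nonneg_of_le_pi ?_ ?_)) ?_
    · exact mul_nonneg hω0.le (by linarith [hx.1])
    · have h3 : ω * (x - a) ≤ ω * a := by
        have := hx.2
        gcongr; linarith
      rwa [hω, div_mul_cancel₀ _ ha0.ne'] at h3
    · have h4 : 1 / (2 * (2 * a)) ≤ 1 / (2 * x) := by
        have := hx.2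
        gcongr
      -- $\pi^2/a^2\le1/(4a)$ is exactly the assumption $a\ge4\pi^2$.
      have h5 : ω ^ 2 ≤ 1 / (2 * (2 * a)) := by
        rw [hω, div_pow, div_le_div_iff₀ (by positivity) (by positivity)]
        nlinarith
      linarith
  have h := hmono (Set.left_mem_Icc.2 (by linarith)) (Set.right_mem_Icc.2 (by linarith))
    (by linarith : a ≤ 2 * a)
  have e : ω * (2 * a - a) = Real.pi := by rw [hω]; field_simp; ring
  simp only [W, e, sub_self, mul_zero, Real.cos_zero, Real.sin_zero, Real.cos_pi,
    Real.sin_pi] at h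
  have p1 := mul_pos (hpos a (Set.left_mem_Icc.2 (by linarith))) hω0
  have p2 := mul_pos (hpos (2 * a) (Set.right_mem_Icc.2 (by linarith))) hω0
  linarith

lemma exists_zero_besselLimit {a : ℝ} (ha : 4 * Real.pi ^ 2 ≤ a) :
    ∃ x ∈ Set.Icc a (2 * a), besselLimit (x : ℂ) = 0 := by
  have ha0 : 0 < a := lt_of_lt_of_le (by positivity) ha
  by_contra hno
  push Not at hno
  have hne : ∀ x ∈ Set.Icc a (2 * a), (besselLimit (x : ℂ)).re ≠ 0 := fun x hx h =>
    hno x hx ((besselLimit_ofReal_eq_zero_iff x).2 h)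
  have hβc : Continuous fun x : ℝ => (besselLimit (x : ℂ)).re := by
    have := differentiable_besselLimit.continuous
    fun_prop
  have hsign : (∀ x ∈ Set.Icc a (2 * a), 0 < (besselLimit (x : ℂ)).re) ∨
      ∀ x ∈ Set.Icc a (2 * a), (besselLimit (x : ℂ)).re < 0 := by
    by_contra hcon
    push Not at hcon
    obtain ⟨⟨x, hx, hx'⟩, ⟨y, hy, hy'⟩⟩ := hcon
    obtain ⟨z, hz, hz0⟩ := (isPreconnected_Icc (a := a) (b := 2 * a)).intermediate_value hx hy
      hβc.continuousOn ⟨hx', hy'⟩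
    exact hne z hz hz0
  have hode : ∀ x ∈ Set.Icc a (2 * a), -(besselLimit (x : ℂ)).re / 2 =
      -(x * (besselLimit (x : ℂ)).re / (2 * x)) := by
    intro x hx
    have : 0 < x := ha0.trans_le hx.1
    field_simp
  rcases hsign with h | h
  · refine not_forall_pos_of_ode ha (fun x _ => hasDerivAt_real_mul_besselLimit x)
      (fun x hx => ?_) fun x hx => mul_pos (ha0.trans_le hx.1) (h x hx)
    rw [← hode x hx]
    exact hasDerivAt_real_besselAux x
  · refine not_forall_pos_of_ode ha (fun x _ => (hasDerivAt_real_mul_besselLimit x).fun_neg)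
      (J := fun x => -(besselAux x).re)
      (fun x hx => ?_) fun x hx => neg_pos.2 (mul_neg_of_pos_of_neg (ha0.trans_le hx.1) (h x hx))
    refine (hasDerivAt_real_besselAux x).fun_neg.congr_deriv ?_
    rw [hode x hx]; ring

/-! ### Enumerating the positive zeros of $J_1$ -/

lemma finite_zeros_closedBall {f : ℂ → ℂ} (hf : Differentiable ℂ f) {a : ℂ} (ha : f a ≠ 0)
    (R : ℝ) : {z ∈ Metric.closedBall (0 : ℂ) R | f z = 0}.Finite := by
  by_contra hinf
  obtain ⟨z, -, hz⟩ := Set.Infinite.exists_accPt_of_subset_isCompact hinf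
    (isCompact_closedBall (0 : ℂ) R) (fun z hz => hz.1)
  rw [accPt_iff_frequently_nhdsNE] at hz
  have h2 := eventually_ne_zero_of_exists_ne_zero hf ha z
  obtain ⟨w, hw1, hw2⟩ := (hz.and_eventually h2).exists
  exact hw2 hw1.2

/-- A locally finite set of reals, bounded below and unbounded above, is the range of a strictly
increasing sequence. -/
lemma exists_strictMono_range_eq {S : Set ℝ} (hfin : ∀ M, (S ∩ Set.Iic M).Finite)
    (hunb : ∀ M, ∃ x ∈ S, M < x) : ∃ j : ℕ → ℝ, StrictMono j ∧ Set.range j = S := by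
  classical
  obtain ⟨x₀, hx₀, -⟩ := hunb 0
  let : LocallyFiniteOrder S := LocallyFiniteOrder.ofFiniteIcc fun a b => by
    refine Set.Finite.of_finite_image (f := Subtype.val) ((hfin b).subset ?_)
      Subtype.val_injective.injOn
    rintro _ ⟨y, hy, rfl⟩
    exact ⟨y.2, hy.2⟩
  have : NoMaxOrder S := ⟨fun a => by
    obtain ⟨x, hx, h⟩ := hunb a
    exact ⟨⟨x, hx⟩, h⟩⟩
  obtain ⟨m, hm, hmin⟩ := Set.exists_min_image _ id (hfin x₀) ⟨x₀, hx₀, Set.mem_Iic.2 le_rfl⟩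
  let : OrderBot S :=
    { bot := ⟨m, hm.1⟩
      bot_le := fun a => by
        change m ≤ a
        rcases le_total (a : ℝ) x₀ with h | h
        · exact hmin a ⟨a.2, h⟩
        · exact (Set.mem_Iic.1 hm.2).trans h }
  let : SuccOrder S := LinearLocallyFiniteOrder.succOrder S
  let : PredOrder S := LinearLocallyFiniteOrder.predOrder S
  -- A locally finite linear order with a least and no greatest element is isomorphic to $\mathbb
  -- N$.
  let e : S ≃o ℕ := orderIsoNatOfLinearSuccPredArch
  refine ⟨fun n => (e.symm n : ℝ), fun a b h => e.symm.strictMono h, ?_⟩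
  ext x
  constructor
  · rintro ⟨n, rfl⟩
    exact (e.symm n).2
  · intro hx
    exact ⟨e ⟨x, hx⟩, by simp⟩

lemma besselJ1_ofReal_eq_zero_iff {x : ℝ} (hx : 0 < x) :
    besselJ1 (x : ℂ) = 0 ↔ besselLimit ((x ^ 2 / 2 : ℝ) : ℂ) = 0 := by
  rw [besselJ1_eq_mul_besselLimit, mul_eq_zero,
    or_iff_right (by exact_mod_cast hx.ne' : (x : ℂ) ≠ 0)]
  push_cast
  rfl

/-- Local finiteness comes from the isolated zeros of the entire function $\beta(z^2/2)$, which is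
nonzero at $0$; unboundedness comes from the Sturm comparison, through $x=\sqrt{2t}$. -/
theorem exists_enumeration_zeros_besselJ1 :
    ∃ j : ℕ → ℝ, StrictMono j ∧ Set.range j = {x : ℝ | 0 < x ∧ besselJ1 (x : ℂ) = 0} := by
  refine exists_strictMono_range_eq (fun M => ?_) fun M => ?_
  · have hg : Differentiable ℂ fun z : ℂ => besselLimit (z ^ 2 / 2) :=
      differentiable_besselLimit.comp (by fun_prop)
    have hfin := finite_zeros_closedBall hg (a := 0) (by norm_num [besselLimit_zero]) M
    refine (hfin.preimage (f := fun x : ℝ => (x : ℂ)) Complex.ofReal_injective.injOn).subset ?_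
    rintro x ⟨⟨hx, hx0⟩, hxM⟩
    refine ⟨?_, ?_⟩
    · rw [mem_closedBall_zero_iff, Complex.norm_real, Real.norm_of_nonneg hx.le]
      exact hxM
    · have := (besselJ1_ofReal_eq_zero_iff hx).1 hx0
      push_cast at this
      exact this
  · obtain ⟨t, ht, ht0⟩ := exists_zero_besselLimit (a := max (4 * Real.pi ^ 2) (M ^ 2 + 1))
      (le_max_left _ _)
    have ht1 : M ^ 2 + 1 ≤ t := (le_max_right _ _).trans ht.1
    have htp : 0 < t := by nlinarith [sq_nonneg M]
    refine ⟨√(2 * t), ⟨by positivity, ?_⟩, ?_⟩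
    · rw [besselJ1_ofReal_eq_zero_iff (by positivity), Real.sq_sqrt (by positivity)]
      rw [show 2 * t / 2 = t by ring]
      exact ht0
    · refine Real.lt_sqrt_of_sq_lt ?_
      linarith

/-! ### Conjugation symmetry and the zeros for large $\alpha$ -/

lemma fAlpha_conj (a : ℝ) {z : ℂ} (hz : 1 < ‖z‖) :
    fAlpha a ((starRingEnd ℂ) z) = (starRingEnd ℂ) (fAlpha a z) := by
  have hs := one_add_inv_mem_slitPlane (mem_cutComplement_of_one_lt_norm hz)
  have harg := (mem_slitPlane_iff_arg.1 hs).1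
  have e : 1 + 1 / (starRingEnd ℂ) z = (starRingEnd ℂ) (1 + 1 / z) := by simp
  rw [fAlpha, fAlpha, e, Complex.log_conj _ harg, map_sub, ← Complex.exp_conj, ← Complex.exp_conj]
  simp

lemma borelIntegral_conj {ρ : ℝ} (hρ : 0 ≤ ρ) {G : ℂ → ℂ}
    (hG : ∀ z, ‖z‖ = ρ → G ((starRingEnd ℂ) z) = (starRingEnd ℂ) (G z)) (s : ℂ) :
    borelIntegral ρ G ((starRingEnd ℂ) s) = (starRingEnd ℂ) (borelIntegral ρ G s) := by
  have hm : ∀ θ : ℝ, circleMap 0 ρ (-θ) = (starRingEnd ℂ) (circleMap 0 ρ θ) := by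
    intro θ
    simp only [circleMap, zero_add, map_mul, Complex.conj_ofReal, ← Complex.exp_conj,
      Complex.conj_I, Complex.ofReal_neg, neg_mul, mul_neg]
  set g : ℂ → ℝ → ℂ := fun s θ =>
    deriv (circleMap 0 ρ) θ • (G (circleMap 0 ρ θ) * Complex.exp (s * circleMap 0 ρ θ)) with hg
  have hsymm : ∀ θ, g ((starRingEnd ℂ) s) (-θ) = -(starRingEnd ℂ) (g s θ) := by
    intro θ
    have hn : ‖circleMap 0 ρ θ‖ = ρ := by rw [norm_circleMap_zero, abs_of_nonneg hρ]
    simp only [hg, deriv_circleMap, smul_eq_mul, map_mul, hm, hG _ hn, Complex.conj_I,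
      ← Complex.exp_conj]
    ring
  have per : Function.Periodic (g ((starRingEnd ℂ) s)) (2 * Real.pi) := by
    intro θ
    have := periodic_circleMap 0 ρ θ
    simp only [hg, deriv_circleMap, this]
  have h1 : ∫ θ in 0..(2 * Real.pi), g ((starRingEnd ℂ) s) θ =
      ∫ θ in 0..(2 * Real.pi), g ((starRingEnd ℂ) s) (-θ) := by
    rw [intervalIntegral.integral_comp_neg, neg_zero]
    have := per.intervalIntegral_add_eq 0 (-(2 * Real.pi))
    simpa using this
  have h2 : ∫ θ in 0..(2 * Real.pi), g ((starRingEnd ℂ) s) θ =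
      -(starRingEnd ℂ) (∫ θ in 0..(2 * Real.pi), g s θ) := by
    rw [h1]
    simp only [hsymm]
    rw [intervalIntegral.integral_neg, intervalIntegral.intervalIntegral_conj]
  change (2 * Real.pi * I : ℂ)⁻¹ * (∫ θ in 0..(2 * Real.pi), g ((starRingEnd ℂ) s) θ) =
    (starRingEnd ℂ) ((2 * Real.pi * I : ℂ)⁻¹ * ∫ θ in 0..(2 * Real.pi), g s θ)
  rw [h2, map_mul, map_inv₀, map_mul, map_mul, Complex.conj_I, Complex.conj_ofReal, map_ofNat,
    mul_neg, mul_neg, inv_neg, neg_mul]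

lemma phi_conj {c r : ℝ} (hc : 1 < c) (hr : 0 < r) (a : ℝ) (s : ℂ) :
    phi c r a ((starRingEnd ℂ) s) = (starRingEnd ℂ) (phi c r a s) := by
  rw [phi_eq_borelIntegral hc hr one_lt_two, phi_eq_borelIntegral hc hr one_lt_two,
    borelIntegral_conj two_pos.le]
  intro z hz
  exact fAlpha_conj a (by rw [hz]; norm_num)

/-- The rescaled functions have a unique, simple zero near each $t_k=j_k^2/2$; dividing it by
$\alpha$ gives $s_k(\alpha)$. The moduli are ordered because those of the rescaled zeros tend to the
increasing numbers $t_k$. -/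
theorem exists_simple_zeros {c r : ℝ} (hc : 1 < c) (hr : 0 < r) {j : ℕ → ℝ} (hj : StrictMono j)
    (hrange : Set.range j = {x : ℝ | 0 < x ∧ besselJ1 (x : ℂ) = 0}) (n : ℕ) :
    ∃ σ : Fin n → ℂ → ℂ,
      (∃ R : ℝ, 0 < R ∧
        (∀ α : ℂ, R < ‖α‖ →
          (∀ k, phi c r α (σ k α) = 0 ∧ deriv (phi c r α) (σ k α) ≠ 0) ∧
          (∀ k, 0 < ‖σ k α‖) ∧ StrictMono (fun k => ‖σ k α‖)) ∧
        (∀ a : ℝ, R < a → ∀ k, 0 < (σ k (a : ℂ)).re ∧ (σ k (a : ℂ)).im = 0)) ∧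
      (∀ k, Tendsto (fun α : ℂ => α * σ k α) (Bornology.cobounded ℂ)
        (𝓝 (((j k) ^ 2 / 2 : ℝ) : ℂ))) := by
  have hjpos : ∀ k, 0 < j k ∧ besselJ1 (j k : ℂ) = 0 := fun k => by
    have : j k ∈ Set.range j := ⟨k, rfl⟩
    rwa [hrange] at this
  set t : ℕ → ℝ := fun k => j k ^ 2 / 2 with ht
  have htpos : ∀ k, 0 < t k := fun k => by
    have := (hjpos k).1
    positivity
  have htmono : StrictMono t := fun a b hab => by
    have h1 := hj hab
    have h2 := (hjpos a).1
    simp only [ht]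
    gcongr
  have ht0 : ∀ k, besselLimit (t k : ℂ) = 0 := fun k =>
    (besselJ1_ofReal_eq_zero_iff (hjpos k).1).1 (hjpos k).2
  set F : ℂ → ℂ → ℂ := fun α s => phi c r α (s / α) / (α * Complex.exp α) with hFdef
  have hF : ∀ α, Differentiable ℂ (F α) := fun α =>
    ((differentiable_phi_right hc hr α).comp (differentiable_id.div_const α)).div_const _
  have key := fun k => exists_tendsto_simple_zero (l := Bornology.cobounded ℂ)
    (F := F) (f := besselLimit) (Eventually.of_forall hF)
    (fun K hK => tendstoUniformlyOn_phi_cobounded hc hr hK) (ht0 k)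
    (deriv_besselLimit_ne_zero (htpos k) (ht0 k))
  choose g ε hε hlim hg using key
  have hnorm : ∀ k, Tendsto (fun α => ‖g k α‖) (Bornology.cobounded ℂ) (𝓝 (t k)) := fun k => by
    have := (hlim k).norm
    rwa [Complex.norm_real, Real.norm_of_nonneg (htpos k).le] at this
  have hne : ∀ᶠ α : ℂ in Bornology.cobounded ℂ, α ≠ 0 := Bornology.eventually_ne_cobounded 0
  have hall : ∀ᶠ α in Bornology.cobounded ℂ, ∀ k : Fin n,
      (F α (g k α) = 0 ∧ deriv (F α) (g k α) ≠ 0 ∧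
        ∀ z ∈ Metric.ball (t k : ℂ) (ε k), F α z = 0 → z = g k α) ∧
      0 < ‖g k α‖ ∧ 0 < (g k α).re ∧ dist (g k α) (t k) < ε k ∧
      ∀ k' : Fin n, k < k' → ‖g k α‖ < ‖g k' α‖ := by
    refine eventually_all.2 fun k => (hg k).and (((hnorm k).eventually_const_lt (htpos k)).and
      (Eventually.and ?_ (Eventually.and (Metric.tendsto_nhds.1 (hlim k) _ (hε k))
      (eventually_all.2 fun k' => ?_))))
    · have := (Complex.continuous_re.tendsto _).comp (hlim k)
      exact this.eventually_const_lt (by simpa using htpos k)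
    · by_cases hk : k < k'
      · filter_upwards [(hnorm k).eventually_lt (hnorm k') (htmono hk)] with α hα _ using hα
      · exact Eventually.of_forall fun α h => absurd h hk
  obtain ⟨R, -, hR⟩ := Filter.hasBasis_cobounded_norm.eventually_iff.1 (hne.and hall)
  refine ⟨fun k α => g k α / α, ⟨max R 1, by positivity, ?_, ?_⟩, ?_⟩
  · intro α hα
    obtain ⟨hα0, hk⟩ := hR (show R ≤ ‖α‖ from (le_max_left R 1).trans hα.le)
    have hαn : 0 < ‖α‖ := norm_pos_iff.2 hα0
    have hαe : α * Complex.exp α ≠ 0 := mul_ne_zero hα0 (Complex.exp_ne_zero _)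
    refine ⟨fun k => ⟨?_, ?_⟩, fun k => ?_, fun k k' hkk' => ?_⟩
    · exact (div_eq_zero_iff.1 (hk k).1.1).resolve_right hαe
    · intro h0
      apply (hk k).1.2.1
      have hphi : HasDerivAt (phi c r α) 0 (g k α / α) := by
        have := (differentiable_phi_right hc hr α (g k α / α)).hasDerivAt
        rwa [h0] at this
      have hcomp : HasDerivAt (F α) (0 * (1 / α) / (α * Complex.exp α)) (g k α) :=
        (hphi.comp (g k α) ((hasDerivAt_id (g k α)).div_const α)).div_const _
      rw [hcomp.deriv]; simp
    · simp only [norm_div]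
      exact div_pos (hk k).2.1 hαn
    · simp only [norm_div]
      exact div_lt_div_of_pos_right ((hk k).2.2.2.2 k' hkk') hαn
  · intro a ha k
    have ha0 : 0 < a := lt_of_lt_of_le one_pos ((le_max_right R 1).trans ha.le)
    obtain ⟨-, hk⟩ := hR (show R ≤ ‖(a : ℂ)‖ by
      rw [Complex.norm_real, Real.norm_of_nonneg ha0.le]; exact (le_max_left R 1).trans ha.le)
    -- For real $a$ the conjugate is again a zero in the same ball, centred at a real point, so
    -- uniqueness makes the zero real.
    have hconj : (starRingEnd ℂ) (g k a) = g k a := by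
      refine (hk k).1.2.2 _ ?_ ?_
      · rw [Metric.mem_ball, ← Complex.conj_ofReal (t k), Complex.dist_conj_conj]
        exact (hk k).2.2.2.1
      · have h0 := (hk k).1.1
        have e : (starRingEnd ℂ) (g k a) / a = (starRingEnd ℂ) (g k a / a) := by simp
        simp only [hFdef, div_eq_zero_iff] at h0 ⊢
        rw [e, phi_conj hc hr, map_eq_zero]
        exact h0
    have him : (g k a).im = 0 := Complex.conj_eq_iff_im.1 hconj
    constructor
    · rw [Complex.div_ofReal_re]
      exact div_pos (hk k).2.2.1 ha0
    · rw [Complex.div_ofReal_im, him, zero_div]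
  · intro k
    refine (hlim k).congr' ?_
    filter_upwards [hne] with α hα
    field_simp

/-! ### Upper bound and Laplace transform -/

lemma norm_phi_le {c r ρ : ℝ} (hc : 1 < c) (hr : 0 < r) (hρ : 1 < ρ) (α : ℂ) :
    ∃ C : ℝ, 0 < C ∧ ∀ s, ‖phi c r α s‖ ≤ C * Real.exp (ρ * ‖s‖) := by
  obtain ⟨C, hC⟩ := (isCompact_sphere (0 : ℂ) ρ).exists_bound_of_continuousOn
    (continuousOn_fAlpha_sphere α hρ)
  refine ⟨ρ * (|C| + 1), by positivity, fun s => ?_⟩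
  rw [phi_eq_borelIntegral hc hr hρ, mul_assoc]
  refine norm_borelIntegral_le (by linarith) s fun z hz => ?_
  linarith [hC z (mem_sphere_zero_iff_norm.2 hz), le_abs_self C]

/-- The Laurent expansion of `f_α` at infinity. -/
lemma exists_laurent_fAlpha (α : ℂ) :
    ∃ A : ℕ → ℂ, ∀ z : ℂ, 1 < ‖z‖ → HasSum (fun n => A n * (1 / z ^ (n + 1))) (fAlpha α z) := by
  -- With $u=1/z$ this is $\mathrm{Log}(1+u)/u$, holomorphic at $0$ with value $1$; hence $g(0)=0$
  -- and the expansion starts at $1/z$.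
  set L : ℂ → ℂ := dslope (fun u => Complex.log (1 + u)) 0 with hL
  set g : ℂ → ℂ := fun u => Complex.exp α - Complex.exp (α * L u) with hg
  have hlog : DifferentiableOn ℂ (fun u => Complex.log (1 + u)) (Metric.ball 0 1) := by
    intro u hu
    have : 1 + u ∈ slitPlane := by
      refine Complex.mem_slitPlane_of_norm_lt_one (mem_ball_zero_iff.1 hu)
    exact (DifferentiableAt.clog (by fun_prop) this).differentiableWithinAt
  have hLd : DifferentiableOn ℂ L (Metric.ball 0 1) :=
    (Complex.differentiableOn_dslope (Metric.ball_mem_nhds 0 one_pos)).2 hlog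
  have hgd : DifferentiableOn ℂ g (Metric.ball 0 1) := (hLd.const_mul α).cexp.const_sub _
  have hL0 : L 0 = 1 := by
    rw [hL, dslope_same]
    have h1 : HasDerivAt (fun u : ℂ => 1 + u) 1 0 := (hasDerivAt_id 0).const_add 1
    have := h1.clog (by simp)
    simpa using this.deriv
  have hg0 : g 0 = 0 := by simp [hg, hL0]
  refine ⟨fun n => ((n + 1).factorial : ℂ)⁻¹ * iteratedDeriv (n + 1) g 0, fun z hz => ?_⟩
  have hz0 : z ≠ 0 := by rintro rfl; simp at hz; linarith
  have hu : 1 / z ∈ Metric.ball (0 : ℂ) 1 := by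
    rw [mem_ball_zero_iff, norm_div, norm_one, div_lt_one (by linarith)]; exact hz
  have h := (hasSum_nat_add_iff' 1).2 (Complex.hasSum_taylorSeries_on_ball hgd hu)
  have e : g (1 / z) = fAlpha α z := by
    have hne : (1 / z : ℂ) ≠ 0 := one_div_ne_zero hz0
    simp only [hg, fAlpha, hL, dslope_of_ne _ hne, slope_def_field]
    simp only [add_zero, Complex.log_one, sub_zero]
    congr 2
    field_simp
  rw [e] at h
  simp only [Finset.sum_range_one, iteratedDeriv_zero, hg0, smul_zero, sub_zero] at h
  refine h.congr_fun fun n => ?_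
  simp only [smul_eq_mul, one_div, inv_pow]
  ring

lemma integral_pow_mul_exp_neg (n : ℕ) {x : ℝ} (hx : 0 < x) :
    ∫ t in Set.Ioi (0 : ℝ), t ^ n * Real.exp (-(x * t)) = n.factorial / x ^ (n + 1) := by
  have h := Real.integral_rpow_mul_exp_neg_mul_Ioi (a := n + 1) (r := x) (by positivity) hx
  simp only [add_sub_cancel_right, Real.rpow_natCast, Real.Gamma_nat_eq_factorial] at h
  rw [h]
  have : (1 / x) ^ ((n : ℝ) + 1) = (1 / x) ^ (n + 1) := by
    rw [← Real.rpow_natCast]; push_cast; rfl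
  rw [this, div_pow, one_pow]; ring

/-- A non-integrable function has integral $0$ by convention, whereas the computed value is
positive. -/
lemma integrableOn_pow_mul_exp_neg (n : ℕ) {x : ℝ} (hx : 0 < x) :
    MeasureTheory.IntegrableOn (fun t : ℝ => t ^ n * Real.exp (-(x * t))) (Set.Ioi 0) := by
  by_contra h
  have h1 := MeasureTheory.integral_undef h
  rw [integral_pow_mul_exp_neg n hx] at h1
  have : (0 : ℝ) < n.factorial / x ^ (n + 1) := by positivity
  linarith

/-- The Laplace transform of `t ↦ φ_α(-t)`. -/
lemma integral_phi_neg {c r : ℝ} (hc : 1 < c) (hr : 0 < r) (α : ℂ) {x : ℝ} (hx : 1 < x) :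
    ∫ t in Set.Ioi (0 : ℝ), phi c r α (-t) * (Real.exp (-(x * t)) : ℂ) = -fAlpha α (-x) := by
  have hx0 : 0 < x := by linarith
  obtain ⟨A, hA⟩ := exists_laurent_fAlpha α
  have hsum : ∀ ρ : ℝ, 1 < ρ → Summable fun n => ‖A n‖ * (ρ⁻¹) ^ (n + 1) := by
    intro ρ hρ
    have hρn : ‖(ρ : ℂ)‖ = ρ := by rw [Complex.norm_real, Real.norm_of_nonneg (by linarith)]
    refine (hA ρ (by rw [hρn]; exact hρ)).summable.norm.congr fun n => ?_
    rw [norm_mul, norm_div, norm_pow, hρn, norm_one, one_div, inv_pow]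
  have hphi : ∀ s, HasSum (fun n => A n * (s ^ n / (n.factorial : ℂ))) (phi c r α s) := by
    intro s
    rw [phi_eq_borelIntegral hc hr one_lt_two]
    exact hasSum_borelIntegral two_pos (hsum 2 one_lt_two)
      (fun z hz => hA z (by rw [hz]; norm_num)) s
  set F : ℕ → ℝ → ℂ := fun n t =>
    (A n * (-1) ^ n / (n.factorial : ℂ)) * ((t ^ n * Real.exp (-(x * t)) : ℝ) : ℂ) with hF
  have hFi : ∀ n, MeasureTheory.Integrable (F n) (MeasureTheory.volume.restrict (Set.Ioi 0)) :=
    fun n => ((integrableOn_pow_mul_exp_neg n hx0).ofReal).const_mul _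
  have hFn : ∀ n, ∫ t in Set.Ioi (0 : ℝ), ‖F n t‖ = ‖A n‖ * (x⁻¹) ^ (n + 1) := by
    intro n
    have e : Set.EqOn (fun t => ‖F n t‖) (fun t => ‖A n‖ / (n.factorial : ℝ) *
        (t ^ n * Real.exp (-(x * t)))) (Set.Ioi 0) := by
      intro t ht
      have ht : (0 : ℝ) < t := ht
      simp only [hF]
      rw [norm_mul, norm_div, norm_mul, norm_pow, norm_neg, norm_one, one_pow, mul_one,
        Complex.norm_natCast, Complex.norm_real, Real.norm_of_nonneg (by positivity)]
    rw [MeasureTheory.setIntegral_congr_fun measurableSet_Ioi e,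
      MeasureTheory.integral_const_mul, integral_pow_mul_exp_neg n hx0]
    have : (n.factorial : ℝ) ≠ 0 := by exact_mod_cast n.factorial_ne_zero
    rw [inv_pow]
    field_simp
  have hFint : ∀ n, ∫ t in Set.Ioi (0 : ℝ), F n t = -(A n * (1 / (-(x : ℂ)) ^ (n + 1))) := by
    intro n
    simp only [hF]
    rw [MeasureTheory.integral_const_mul, integral_complex_ofReal, integral_pow_mul_exp_neg n hx0]
    have : (n.factorial : ℂ) ≠ 0 := by exact_mod_cast n.factorial_ne_zero
    have hxc : (x : ℂ) ≠ 0 := by exact_mod_cast hx0.ne'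
    have h1 : ((-1 : ℂ) ^ n) * (-1) ^ n = 1 := by rw [← mul_pow]; simp
    push_cast
    rw [neg_pow (x : ℂ), pow_succ (-1 : ℂ)]
    have h2 : (-1 : ℂ) ^ n ≠ 0 := pow_ne_zero _ (by norm_num)
    field_simp
    linear_combination A n * h1
  -- Each integral restores the $n!$ removed by the Borel transform, so the interchange needs only
  -- absolute convergence of the Laurent series at radius $x>1$.
  have hmain := MeasureTheory.hasSum_integral_of_summable_integral_norm hFi
    (by simpa only [hFn] using hsum x hx)
  simp only [hFint] at hmain
  have hxn : ‖(-x : ℂ)‖ = x := by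
    rw [norm_neg, Complex.norm_real, Real.norm_of_nonneg hx0.le]
  have h2 := (hA (-x : ℂ) (by rw [hxn]; exact hx)).neg
  rw [h2.unique hmain]
  refine MeasureTheory.integral_congr_ae (Eventually.of_forall fun t => ?_)
  change phi c r α (-t) * (Real.exp (-(x * t)) : ℂ) = ∑' n, F n t
  have h3 := (hphi (-t)).mul_right ((Real.exp (-(x * t)) : ℝ) : ℂ)
  rw [← h3.tsum_eq]
  refine tsum_congr fun n => ?_
  simp only [hF]
  rw [neg_pow (t : ℂ)]
  push_cast
  ring

/-- For `a > 0`, `φ_a` does not grow slower than `e^{τ t}` on the negative axis for any `τ < 1`. -/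
lemma not_phi_neg_le {c r : ℝ} (hc : 1 < c) (hr : 0 < r) {a : ℝ} (ha : 0 < a) {τ C : ℝ}
    (hτ : τ < 1) : ¬ ∀ t : ℝ, 0 ≤ t → ‖phi c r a (-t)‖ ≤ C * Real.exp (τ * t) := by
  intro h
  have hC : 0 ≤ C := by
    have := (norm_nonneg _).trans (h 0 le_rfl)
    simpa using this
  have hbound : ∀ x : ℝ, 1 < x → ‖fAlpha a (-x)‖ ≤ C / (1 - τ) := by
    intro x hx
    have hxτ : 0 < x - τ := by linarith
    rw [← norm_neg, ← integral_phi_neg hc hr a hx]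
    have hint := integrableOn_pow_mul_exp_neg 0 hxτ
    have hval := integral_pow_mul_exp_neg 0 hxτ
    simp only [pow_zero, one_mul, Nat.factorial_zero, Nat.cast_one, zero_add, pow_one] at hint hval
    have h1 := MeasureTheory.norm_integral_le_of_norm_le (hint.const_mul C)
      (f := fun t : ℝ => phi c r a (-t) * (Real.exp (-(x * t)) : ℂ)) (by
        refine (MeasureTheory.ae_restrict_iff' measurableSet_Ioi).2 (Eventually.of_forall
          fun t ht => ?_)
        have ht : (0 : ℝ) < t := ht
        rw [norm_mul, Complex.norm_real, Real.norm_of_nonneg (Real.exp_pos _).le]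
        calc ‖phi c r a (-t)‖ * Real.exp (-(x * t))
            ≤ C * Real.exp (τ * t) * Real.exp (-(x * t)) := by
              have := h t ht.le
              gcongr
          _ = C * Real.exp (-((x - τ) * t)) := by
              rw [mul_assoc, ← Real.exp_add]; congr 2; ring)
    rw [MeasureTheory.integral_const_mul, hval] at h1
    refine h1.trans ?_
    rw [mul_one_div]
    gcongr
  have hN : ∀ N : ℝ, 0 < N → Real.exp (a * N) ≤ C / (1 - τ) + Real.exp a := by
    intro N hN
    set η : ℝ := Real.exp (-N) with hη
    have hη0 : 0 < η := Real.exp_pos _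
    have hη1 : η < 1 := by rw [hη, Real.exp_lt_one_iff]; linarith
    -- Chosen so that $1-1/x=e^{-N}$; then $f_a(-x)=e^a-e^{axN}$ with $x>1$, which is unbounded as
    -- $N\to\infty$.
    set x : ℝ := 1 / (1 - η) with hx
    have hx1 : 1 < x := by rw [hx, lt_div_iff₀ (by linarith)]; linarith
    have e1 : (1 : ℂ) + 1 / (-(x : ℂ)) = (η : ℂ) := by
      have hne : (1 - (η : ℂ)) ≠ 0 := by
        have : (1 - η : ℝ) ≠ 0 := by linarith
        exact_mod_cast this
      rw [hx]
      push_cast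
      field_simp
      ring
    have e2 : Complex.log (η : ℂ) = ((-N : ℝ) : ℂ) := by
      rw [← Complex.ofReal_log hη0.le, hη, Real.log_exp]
    have e3 : fAlpha a (-x) = Complex.exp a - ((Real.exp (a * x * N) : ℝ) : ℂ) := by
      rw [fAlpha, e1, e2]
      push_cast
      congr 2; ring
    have h1 := hbound x hx1
    rw [e3] at h1
    have h2 : Real.exp (a * x * N) ≤ ‖Complex.exp a - ((Real.exp (a * x * N) : ℝ) : ℂ)‖ +
        ‖Complex.exp a‖ := by
      have := norm_sub_norm_le ((Real.exp (a * x * N) : ℝ) : ℂ) (Complex.exp a)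
      rw [norm_sub_rev, Complex.norm_real, Real.norm_of_nonneg (Real.exp_pos _).le] at this
      linarith
    rw [Complex.norm_exp, Complex.ofReal_re] at h2
    have h3 : Real.exp (a * N) ≤ Real.exp (a * x * N) := by
      rw [Real.exp_le_exp]
      nlinarith [mul_pos ha hN]
    linarith
  obtain ⟨N, hN1, hN2⟩ := ((tendsto_const_mul_atTop_of_pos ha).2 tendsto_id |>.eventually_gt_atTop
    (C / (1 - τ) + Real.exp a)).and (eventually_gt_atTop 0) |>.exists
  have h1 := hN N hN2
  have h2 := Real.add_one_le_exp (a * N)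
  simp only [id] at hN1
  linarith

/-! ### Order and type from the maximum modulus -/

section MaxModulus

variable {f : ℂ → ℂ}

lemma norm_le_maxModulus (hf : Continuous f) (z : ℂ) : ‖f z‖ ≤ maxModulus f ‖z‖ :=
  le_csSup ((isCompact_sphere _ _).image hf.norm).bddAbove ⟨z, by simp, rfl⟩

lemma maxModulus_le {R B : ℝ} (hR : 0 ≤ R) (h : ∀ z, ‖z‖ = R → ‖f z‖ ≤ B) :
    maxModulus f R ≤ B := by
  refine csSup_le ((NormedSpace.sphere_nonempty.2 hR).image _) ?_
  rintro _ ⟨z, hz, rfl⟩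
  exact h z (mem_sphere_zero_iff_norm.1 hz)

lemma maxModulus_mono (hf : Differentiable ℂ f) {R S : ℝ} (hR : 0 ≤ R) (hRS : R ≤ S) :
    maxModulus f R ≤ maxModulus f S := by
  refine maxModulus_le hR fun z hz => ?_
  rcases hRS.eq_or_lt with rfl | hlt
  · rw [← hz]; exact norm_le_maxModulus hf.continuous z
  have hS : S ≠ 0 := by linarith
  refine Complex.norm_le_of_forall_mem_frontier_norm_le (U := Metric.ball 0 S)
    Metric.isBounded_ball hf.diffContOnCl (fun w hw => ?_) (subset_closure ?_)
  · rw [frontier_ball _ hS, mem_sphere_zero_iff_norm] at hw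
    rw [← hw]; exact norm_le_maxModulus hf.continuous w
  · rw [mem_ball_zero_iff, hz]; exact hlt

lemma entireType_eq_one (hge : ∀ᶠ R in atTop, 1 ≤ maxModulus f R)
    (hup : ∀ ρ : ℝ, 1 < ρ → ∃ C : ℝ, 0 < C ∧ ∀ s, ‖f s‖ ≤ C * Real.exp (ρ * ‖s‖))
    (hlow : ∀ b : ℝ, b < 1 → ∃ᶠ R in atTop, b ≤ Real.log (maxModulus f R) / R) :
    entireType 1 f = 1 := by
  rw [entireType]
  simp only [Real.rpow_one]
  refine le_antisymm ?_ ?_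
  · refine le_of_forall_gt_imp_ge_of_dense fun b hb => ?_
    obtain ⟨β, hβ1, hβ2⟩ := EReal.lt_iff_exists_real_btwn.1 hb
    have hβ : 1 < β := by exact_mod_cast hβ1
    refine limsup_le_of_le (by isBoundedDefault) ?_
    -- A rate strictly between $1$ and $\beta$ leaves $(\beta-1)R/2$ to absorb $\log C$.
    obtain ⟨C, hC, hCb⟩ := hup ((1 + β) / 2) (by linarith)
    filter_upwards [hge, eventually_gt_atTop 0,
      eventually_ge_atTop (Real.log C / ((β - 1) / 2))] with R h1 h2 h3
    refine le_trans (EReal.coe_le_coe_iff.2 ?_) hβ2.le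
    have h4 : maxModulus f R ≤ C * Real.exp ((1 + β) / 2 * R) :=
      maxModulus_le h2.le fun z hz => by rw [← hz]; exact hCb z
    have h5 := Real.log_le_log (by linarith) h4
    rw [Real.log_mul hC.ne' (Real.exp_pos _).ne', Real.log_exp] at h5
    rw [div_le_iff₀ (by linarith)] at h3
    rw [div_le_iff₀ h2]
    nlinarith
  · refine le_of_forall_lt_imp_le_of_dense fun b hb => ?_
    obtain ⟨β, hβ1, hβ2⟩ := EReal.lt_iff_exists_real_btwn.1 hb
    have hβ : β < 1 := by exact_mod_cast hβ2
    refine hβ1.le.trans (le_limsup_of_frequently_le ?_ (by isBoundedDefault))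
    exact (hlow β hβ).mono fun R hR => EReal.coe_le_coe_iff.2 hR

lemma entireOrder_eq_one (hge : ∀ᶠ R in atTop, Real.exp 1 ≤ maxModulus f R)
    (hup : ∀ ρ : ℝ, 1 < ρ → ∃ C : ℝ, 0 < C ∧ ∀ s, ‖f s‖ ≤ C * Real.exp (ρ * ‖s‖))
    (hlow : ∀ b : ℝ, b < 1 → ∃ᶠ R in atTop, b ≤ Real.log (maxModulus f R) / R) :
    entireOrder f = 1 := by
  rw [entireOrder]
  refine le_antisymm ?_ ?_
  · refine le_of_forall_gt_imp_ge_of_dense fun b hb => ?_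
    obtain ⟨β, hβ1, hβ2⟩ := EReal.lt_iff_exists_real_btwn.1 hb
    have hβ : 1 < β := by exact_mod_cast hβ1
    refine limsup_le_of_le (by isBoundedDefault) ?_
    obtain ⟨C, hC, hCb⟩ := hup 2 (by linarith)
    filter_upwards [hge, eventually_gt_atTop 1, eventually_ge_atTop (Real.log C),
      Real.tendsto_log_atTop.eventually_ge_atTop (Real.log 3 / (β - 1))] with R h1 h2 h3 h6
    refine le_trans (EReal.coe_le_coe_iff.2 ?_) hβ2.le
    have h4 : maxModulus f R ≤ C * Real.exp (2 * R) :=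
      maxModulus_le (by linarith) fun z hz => by rw [← hz]; exact hCb z
    have hM : 0 < maxModulus f R := (Real.exp_pos 1).trans_le h1
    have h5 := Real.log_le_log hM h4
    rw [Real.log_mul hC.ne' (Real.exp_pos _).ne', Real.log_exp] at h5
    have h7 : 1 ≤ Real.log (maxModulus f R) := (Real.le_log_iff_exp_le hM).2 h1
    have h8 : Real.log (Real.log (maxModulus f R)) ≤ Real.log (3 * R) :=
      Real.log_le_log (by linarith) (by linarith)
    rw [Real.log_mul (by norm_num) (by linarith)] at h8
    rw [div_le_iff₀ (by linarith)] at h6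
    rw [div_le_iff₀ (Real.log_pos h2)]
    nlinarith
  · refine le_of_forall_lt_imp_le_of_dense fun b hb => ?_
    obtain ⟨β, hβ1, hβ2⟩ := EReal.lt_iff_exists_real_btwn.1 hb
    have hβ : β < 1 := by exact_mod_cast hβ2
    refine hβ1.le.trans (le_limsup_of_frequently_le ?_ (by isBoundedDefault))
    refine ((hlow (1 / 2) (by norm_num)).and_eventually ((eventually_gt_atTop 1).and
      (Real.tendsto_log_atTop.eventually_ge_atTop (Real.log 2 / (1 - β))))).mono ?_
    rintro R ⟨h1, h2, h3⟩
    refine EReal.coe_le_coe_iff.2 ?_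
    rw [le_div_iff₀ (by linarith)] at h1
    have h4 : Real.log (R / 2) ≤ Real.log (Real.log (maxModulus f R)) :=
      Real.log_le_log (by linarith) (by linarith)
    rw [Real.log_div (by linarith) (by norm_num)] at h4
    rw [div_le_iff₀ (by linarith)] at h3
    rw [le_div_iff₀ (Real.log_pos h2)]
    nlinarith

end MaxModulus

/-- Otherwise $M(R)\le e^{bR}$ for all large $R$; compactness handles the remaining $t$, and
$\varphi_a(-t)$ would be $O(e^{bt})$ with $b<1$. -/
lemma frequently_le_log_maxModulus_phi {c r : ℝ} (hc : 1 < c) (hr : 0 < r) {a : ℝ} (ha : 0 < a)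
    {b : ℝ} (hb : b < 1) :
    ∃ᶠ R in atTop, b ≤ Real.log (maxModulus (phi c r a) R) / R := by
  have hd := differentiable_phi_right hc hr (a : ℂ)
  intro hcon
  simp only [not_le] at hcon
  obtain ⟨T, hT⟩ := eventually_atTop.1 (hcon.and (eventually_gt_atTop 0))
  have hlarge : ∀ R, T ≤ R → maxModulus (phi c r a) R ≤ Real.exp (b * R) := by
    intro R hR
    obtain ⟨h1, h2⟩ := hT R hR
    rw [div_lt_iff₀ h2] at h1
    rcases le_or_gt (maxModulus (phi c r a) R) 0 with h3 | h3
    · exact h3.trans (Real.exp_pos _).le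
    · exact ((Real.log_lt_iff_lt_exp h3).1 h1).le
  obtain ⟨C, hC⟩ := (isCompact_Icc (a := (0 : ℝ)) (b := T)).exists_bound_of_continuousOn
    (f := fun t : ℝ => phi c r a (-t) / (Real.exp (b * t) : ℂ)) (by
      refine Continuous.continuousOn ?_
      have := hd.continuous
      refine Continuous.div (by fun_prop) (by fun_prop) fun t => ?_
      exact_mod_cast (Real.exp_pos _).ne')
  refine not_phi_neg_le hc hr ha hb (C := max C 1) fun t ht => ?_
  rcases le_total T t with h | h
  · have h1 := norm_le_maxModulus hd.continuous (-t : ℂ)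
    rw [norm_neg, Complex.norm_real, Real.norm_of_nonneg ht] at h1
    calc ‖phi c r a (-t)‖ ≤ 1 * Real.exp (b * t) := by rw [one_mul]; exact h1.trans (hlarge t h)
      _ ≤ max C 1 * Real.exp (b * t) := by gcongr; exact le_max_right _ _
  · have h1 := hC t ⟨ht, h⟩
    rw [norm_div, Complex.norm_real, Real.norm_of_nonneg (Real.exp_pos _).le,
      div_le_iff₀ (Real.exp_pos _)] at h1
    refine h1.trans ?_
    gcongr
    exact le_max_left _ _

/-- One radius $R_0\ge2$ with $\log M(R_0)\ge R_0/2\ge1$ suffices, as $M$ is increasing by the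
maximum principle. The bound keeps $\log M\ge1$, so that $\log\log M$ behaves well. -/
lemma eventually_exp_one_le_maxModulus_phi {c r : ℝ} (hc : 1 < c) (hr : 0 < r) {a : ℝ}
    (ha : 0 < a) : ∀ᶠ R in atTop, Real.exp 1 ≤ maxModulus (phi c r a) R := by
  have hd := differentiable_phi_right hc hr (a : ℂ)
  obtain ⟨R₀, h1, h2⟩ := ((frequently_le_log_maxModulus_phi hc hr ha
    (b := 1 / 2) (by norm_num)).and_eventually (eventually_ge_atTop 2)).exists
  rw [le_div_iff₀ (by linarith)] at h1
  have h3 : 1 ≤ Real.log (maxModulus (phi c r a) R₀) := by linarith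
  have h0 : 0 ≤ maxModulus (phi c r a) R₀ := by
    have := norm_le_maxModulus hd.continuous (R₀ : ℂ)
    rw [Complex.norm_real, Real.norm_of_nonneg (by linarith)] at this
    exact (norm_nonneg _).trans this
  have hpos : 0 < maxModulus (phi c r a) R₀ := by
    refine lt_of_le_of_ne h0 fun h => ?_
    rw [← h, Real.log_zero] at h3
    linarith
  have h4 := (Real.le_log_iff_exp_le hpos).1 h3
  filter_upwards [eventually_ge_atTop R₀] with R hR
  exact h4.trans (maxModulus_mono hd (by linarith) hR)

theorem entireOrder_phi {c r : ℝ} (hc : 1 < c) (hr : 0 < r) {a : ℝ} (ha : 0 < a) :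
    entireOrder (phi c r a) = 1 :=
  entireOrder_eq_one (eventually_exp_one_le_maxModulus_phi hc hr ha)
    (fun _ hρ => norm_phi_le hc hr hρ a) fun _ hb => frequently_le_log_maxModulus_phi hc hr ha hb

theorem entireType_phi {c r : ℝ} (hc : 1 < c) (hr : 0 < r) {a : ℝ} (ha : 0 < a) :
    entireType 1 (phi c r a) = 1 :=
  entireType_eq_one
    ((eventually_exp_one_le_maxModulus_phi hc hr ha).mono fun _ h =>
      (Real.one_le_exp zero_le_one).trans h)
    (fun _ hρ => norm_phi_le hc hr hρ a) fun _ hb => frequently_le_log_maxModulus_phi hc hr ha hb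

theorem theorem1p3 (c r : ℝ) (hc : 1 < c) (hr : 0 < r) :
    -- `(α, s) ↦ φ_α(s)` is entire on `ℂ²`
    Differentiable ℂ (fun p : ℂ × ℂ => phi c r p.1 p.2) ∧
    -- (i)
    ((∀ K : Set ℂ, IsCompact K →
        TendstoUniformlyOn (fun α s => phi c r α s / (α * Complex.exp α)) limitW (𝓝[≠] 0) K) ∧
      (∀ s : ℂ, HasSum (fun n : ℕ => (-1) ^ n / ((n : ℂ) + 2) * (s ^ n / (n.factorial : ℂ)))
        (limitW s)) ∧
      (∀ x : ℝ, limitW (x : ℂ) ≠ 0) ∧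
      {s : ℂ | limitW s = 0}.Infinite ∧
      (∀ s : ℂ, limitW s = 0 ↔ s ≠ 0 ∧ Complex.exp s = 1 + s) ∧
      {s : ℂ | limitW s = 0} = xi '' {k : ℤ | k ≠ -1 ∧ k ≠ 0} ∧
      xi 1 = (starRingEnd ℂ) (xi (-2)) ∧
      |(xi 1).re - 2.08884| < 0.00001 ∧ |(xi 1).im + 7.46148| < 0.00001 ∧
      xi 2 = (starRingEnd ℂ) (xi (-3)) ∧
      |(xi 2).re - 2.66406| < 0.00001 ∧ |(xi 2).im + 13.87905| < 0.00001) ∧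
    -- (ii)
    (∀ n : ℕ, ∃ δ : ℝ, 0 < δ ∧ ∀ α : ℂ, ‖α‖ < δ →
      ∃ S : Finset ℂ, S.card = n ∧ ∀ s ∈ S, phi c r α s = 0 ∧ s.im ≠ 0) ∧
    -- (iii)
    (∀ K : Set ℂ, IsCompact K →
      TendstoUniformlyOn (fun α s => phi c r α (s / α) / (α * Complex.exp α)) besselLimit
        (Bornology.cobounded ℂ) K) ∧
    -- (iv), where `j k` is the `(k + 1)`-st positive zero of `J_1`
    (∃ j : ℕ → ℝ, StrictMono j ∧ Set.range j = {x : ℝ | 0 < x ∧ besselJ1 (x : ℂ) = 0} ∧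
      ∀ n : ℕ, ∃ σ : Fin n → ℂ → ℂ,
        (∃ R : ℝ, 0 < R ∧
          (∀ α : ℂ, R < ‖α‖ →
            (∀ k, phi c r α (σ k α) = 0 ∧ deriv (phi c r α) (σ k α) ≠ 0) ∧
            (∀ k, 0 < ‖σ k α‖) ∧ StrictMono (fun k => ‖σ k α‖)) ∧
          (∀ a : ℝ, R < a → ∀ k, 0 < (σ k (a : ℂ)).re ∧ (σ k (a : ℂ)).im = 0)) ∧
        (∀ k, Tendsto (fun α : ℂ => α * σ k α) (Bornology.cobounded ℂ)
          (𝓝 (((j k) ^ 2 / 2 : ℝ) : ℂ)))) ∧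
    -- (v)
    (∀ a : ℝ, 0 < a → Differentiable ℂ (phi c r (a : ℂ)) ∧
      entireOrder (phi c r (a : ℂ)) = 1 ∧ entireType 1 (phi c r (a : ℂ)) = 1) := by
  obtain ⟨j, hj, hrange⟩ := exists_enumeration_zeros_besselJ1
  have h12 := xi_eq_conj (k := 1) (by norm_num) (by norm_num)
  have h23 := xi_eq_conj (k := 2) (by norm_num) (by norm_num)
  norm_num at h12 h23
  exact ⟨differentiable_phi hc hr,
    ⟨fun K hK => tendstoUniformlyOn_phi_zero hc hr hK, hasSum_limitW, limitW_ofReal_ne_zero,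
      infinite_zeros_limitW, limitW_eq_zero_iff, zeros_limitW_eq_image_xi, h12, xi_one_approx.1,
      xi_one_approx.2, h23, xi_two_approx.1, xi_two_approx.2⟩,
    exists_nonreal_zeros hc hr,
    fun K hK => tendstoUniformlyOn_phi_cobounded hc hr hK,
    ⟨j, hj, hrange, exists_simple_zeros hc hr hj hrange⟩,
    fun a ha => ⟨differentiable_phi_right hc hr a, entireOrder_phi hc hr ha,
      entireType_phi hc hr ha⟩⟩
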